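/- Let $(Z_j,\varepsilon_j)$, $j\ge 1$, be independent and identically distributed pairs of real random variables with $Z_j$ independent of $\varepsilon_j$. Assume that $Z_1$ has a bounded Lebesgue density $g$ whose restriction to $[0,1]$ is continuous and bounded away from zero, and that $E[\varepsilon_1]=0$ and $E|\varepsilon_1|^\beta<\infty$ for some $\beta>2$. Let the kernel $w$ be a symmetric probability density on $\mathbb{R}$ that vanishes outside $[-1,1]$ and is differentiable with bounded derivative $w'$. Let $d\ge 0$ be an integer, and let $c_n>0$ satisfy $c_n\to 0$ and $c_n^{-1}n^{2/\beta}=O(n/\log n)$. For $m\ge 0$ put $w_{nm}(x)=\frac{x^m}{c_n^{m+1}}\,w(x/c_n)$ and $\bar q_{nm}(x)=E\big[\frac1n\sum_{j=1}^n w_{nm}(Z_j-x)\big]$. Let $\bar Q_n(x)$ be the $(d+1)\times(d+1)$ matrix with entries $\bar q_{n,k+m}(x)$, $k,m=0,\dots,d$ (it is invertible for all $x\in[0,1]$ once $n$ is large), let $\bar p_n(x)$ be the first column of $\bar Q_n(x)^{-1}$, and put $\bar A_n(x,y)=\sum_{m=0}^d \bar p_{nm}(x)\,w_{nm}(y-x)$.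 Then $$\sup_{0\le x\le 1}\Big|\frac1n\sum_{j=1}^n\bar A_n(x,Z_j)\varepsilon_j\Big|=O_p\big((nc_n/\log n)^{-1/2}\big).$$ Let moreover $I\supseteq[0,1]$ be an interval with $P(Z_1\in I)=1$ (for instance $I=[0,1]$ if the covariates take values in $[0,1]$, or $I=\mathbb{R}$), let $r$ be a real function on $I$, and let $Y_j=r(Z_j)+\varepsilon_j$. Let $\hat r$ be the local polynomial smoother of order $d$: for $x\in[0,1]$, $\hat r(x)=\beta_0$, where $(\beta_0,\dots,\beta_d)$ is a minimizer (an arbitrary one, if there are several) of $$\sum_{j=1}^n\Big(Y_j-\sum_{m=0}^d\beta_m\Big(\frac{Z_j-x}{c_n}\Big)^m\Big)^2\frac1{c_n}w\Big(\frac{Z_j-x}{c_n}\Big).$$ If $r$ is $\nu$-times continuously differentiable on $I$ for an integer $0\le\nu\le d$, then $$\sup_{0\le x\le 1}\Big|\hat r(x)-r(x)-\frac1n\sum_{j=1}^n\bar A_n(x,Z_j)\varepsilon_j\Big|=O_p\Big(\frac{\log n}{nc_n}\Big)+o_p(c_n^\nu).$$ If $r$ has a Lipschitz continuous $d$-th derivative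 on $I$, then $o_p(c_n^\nu)$ can be replaced by $O_p(c_n^{d+1})$. -/

import Mathlib

open Filter Topology MeasureTheory ProbabilityTheory Asymptotics
open scoped ENNReal NNReal

noncomputable section

namespace LocalPoly

/-- `X n = O_p(a n)`, for `[0, ∞]`-valued `X n` (no measurability is presupposed: `P` of a set is its
outer measure). -/
def IsBigOP {Ω : Type*} [MeasurableSpace Ω] (P : Measure Ω) (X : ℕ → Ω → ℝ≥0∞) (a : ℕ → ℝ) : Prop :=
  ∀ η : ℝ≥0∞, 0 < η → ∃ M : ℝ, 0 < M ∧ ∀ᶠ n in atTop,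
    P {ω | ENNReal.ofReal (M * a n) < X n ω} ≤ η

/-- `X n = o_p(a n)`, for `[0, ∞]`-valued `X n`. -/
def IsLittleOP {Ω : Type*} [MeasurableSpace Ω] (P : Measure Ω) (X : ℕ → Ω → ℝ≥0∞) (a : ℕ → ℝ) :
    Prop :=
  ∀ δ : ℝ, 0 < δ → Tendsto (fun n => P {ω | ENNReal.ofReal (δ * a n) < X n ω}) atTop (𝓝 0)

/-- `sup_{0 ≤ x ≤ 1} |h x|`, as an element of `[0, ∞]`. -/
def supUnit (h : ℝ → ℝ) : ℝ≥0∞ := ⨆ x ∈ Set.Icc (0 : ℝ) 1, ENNReal.ofReal |h x|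

/-- A symmetric probability density with support in `[-1, 1]` and a bounded derivative. -/
structure IsKernel (w : ℝ → ℝ) : Prop where
  nonneg : ∀ t, 0 ≤ w t
  integrable : Integrable w
  integral_eq_one : ∫ t, w t = 1
  symm : ∀ t, w (-t) = w t
  support : ∀ t, t ∉ Set.Icc (-1 : ℝ) 1 → w t = 0
  differentiable : Differentiable ℝ w
  deriv_bounded : ∃ C, ∀ t, |deriv w t| ≤ C

/-- `g` is a bounded Lebesgue density on `ℝ` whose restriction to `[0, 1]` is continuous and bounded
away from zero. -/
structure IsCovariateDensity (g : ℝ → ℝ) : Prop where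
  measurable : Measurable g
  nonneg : ∀ x, 0 ≤ g x
  bounded : ∃ C, ∀ x, g x ≤ C
  bounded_below : ∃ b, 0 < b ∧ ∀ x ∈ Set.Icc (0 : ℝ) 1, b ≤ g x
  continuousOn : ContinuousOn g (Set.Icc 0 1)

/-- The locally weighted least squares criterion of degree `d` at `x`, with bandwidth `c`, for the
data `(Z j, Y j)`, `j < n`, as a function of the (rescaled) coefficients `b`. -/
def loss (w : ℝ → ℝ) (d : ℕ) (c : ℝ) (n : ℕ) (Z Y : ℕ → ℝ) (x : ℝ) (b : Fin (d + 1) → ℝ) : ℝ :=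
  ∑ j ∈ Finset.range n,
    (Y j - ∑ m : Fin (d + 1), b m * ((Z j - x) / c) ^ (m : ℕ)) ^ 2 * (1 / c * w ((Z j - x) / c))

/-- `v` is a value at `x` of the local polynomial smoother of order `d`: the coefficient of degree
zero of a minimizer of the criterion. -/
def IsSmootherValue (w : ℝ → ℝ) (d : ℕ) (c : ℝ) (n : ℕ) (Z Y : ℕ → ℝ) (x v : ℝ) : Prop :=
  ∃ b : Fin (d + 1) → ℝ, (∀ b', loss w d c n Z Y x b ≤ loss w d c n Z Y x b') ∧ b 0 = v

/-- `w_{nm}(x) = x^m / c^(m+1) * w (x / c)`. -/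
def wScaled (w : ℝ → ℝ) (c : ℝ) (m : ℕ) (x : ℝ) : ℝ := x ^ m / c ^ (m + 1) * w (x / c)

/-- `q_{nm}(x)`, the empirical mean of `w_{nm}(Z j - x)`, `j < n`. -/
def q (w : ℝ → ℝ) (c : ℝ) (n m : ℕ) (Z : ℕ → ℝ) (x : ℝ) : ℝ :=
  1 / (n : ℝ) * ∑ j ∈ Finset.range n, wScaled w c m (Z j - x)

/-- The expectation of `q_{nm}(x)`. -/
def qBar {Ω : Type*} [MeasurableSpace Ω] (P : Measure Ω) (w : ℝ → ℝ) (c : ℝ) (n m : ℕ)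
    (Z : ℕ → Ω → ℝ) (x : ℝ) : ℝ :=
  ∫ ω, q w c n m (fun j => Z j ω) x ∂P

/-- The matrix with entries `E[q_{n,k+m}(x)]`, `k, m = 0, …, d`. -/
def QBar {Ω : Type*} [MeasurableSpace Ω] (P : Measure Ω) (w : ℝ → ℝ) (d : ℕ) (c : ℝ) (n : ℕ)
    (Z : ℕ → Ω → ℝ) (x : ℝ) : Matrix (Fin (d + 1)) (Fin (d + 1)) ℝ :=
  Matrix.of fun k m => qBar P w c n ((k : ℕ) + (m : ℕ)) Z x

/-- `Ā_n(x, y)`: the first column of `(QBar x)⁻¹`, paired with the vector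
`(w_{n0}(y - x), …, w_{nd}(y - x))`. -/
def ABar {Ω : Type*} [MeasurableSpace Ω] (P : Measure Ω) (w : ℝ → ℝ) (d : ℕ) (c : ℝ) (n : ℕ)
    (Z : ℕ → Ω → ℝ) (x y : ℝ) : ℝ :=
  ∑ m : Fin (d + 1), (QBar P w d c n Z x)⁻¹ m 0 * wScaled w c m (y - x)

/-- The linearized noise term `(1/n) ∑_j Ā_n(x, Z_j) ε_j`. -/
def noise {Ω : Type*} [MeasurableSpace Ω] (P : Measure Ω) (w : ℝ → ℝ) (d : ℕ) (c : ℝ) (n : ℕ)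
    (Z ε : ℕ → Ω → ℝ) (ω : Ω) (x : ℝ) : ℝ :=
  1 / (n : ℝ) * ∑ j ∈ Finset.range n, ABar P w d c n Z x (Z j ω) * ε j ω

end LocalPoly

end

/-! ### Exponential inequalities for bounded independent sums -/

namespace LocalPoly

/-! A minimizer `b` solves the normal equations. Subtracting a polynomial `b₀` that approximates `r`
near `x`, with `b₀ 0 = r x`, turns them into `Q̂ (b - b₀) = S + ρ`, where `Q̂` is the matrix of
empirical kernel moments, `S` the vector of kernel weighted means of the errors and `ρ` the weighted
approximation residual (`exists_QHat_mulVec_eq`). The expected matrix `Q̄` is symmetric, so the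
linearized noise is coordinate 0 of `Q̄⁻¹ S` (`noise_eq`), and it remains to compare `b - b₀` with
`Q̄⁻¹ S`.

That comparison is deterministic (`IsCoercive.norm_sub_inv_mulVec_le`): if `Q̄` is coercive and `Q̂`
is close to it, the difference is at most a constant times `‖Q̂ - Q̄‖ ‖S‖ + ‖ρ‖`. Coercivity is
uniform in `x` and `n` (`exists_isCoercive_QBar`): the quadratic form of `Q̄` is the mean of a
squared polynomial weighted by the kernel, and for small `c` one half of each window lies in `[0,
1]`, where `g` is bounded below.

Both random factors come from one estimate, `IsSample.isBigOP_supUnit_sub`, on the uniform deviation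
of kernel weighted means of variables `η j`. Taking `η = 1` controls `Q̂ - Q̄`; taking `η = ε`
controls `S`, which has mean zero. The product has order `rate ^ 2 = log n / (n c)`. The estimate
itself follows by truncating `η` at a multiple of `n ^ (1 / β)`, applying the Bernstein inequality
on a grid of `n ^ 2 + 1` points and interpolating by Lipschitz continuity. The bandwidth condition
says that `rate * n ^ (1 / β)` stays bounded, which keeps the truncated summands within the range of
the Bernstein inequality.

Finally `‖ρ‖` is at most the Taylor error times a bounded moment. The Taylor error is `e * c ^ ν`,
with `e` a bound for the oscillation of the `ν`-th derivative over a window: `e` tends to zero by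
uniform continuity, and is `K * c` under a Lipschitz condition. -/

theorem mgf_le_of_abs_le {Ω : Type*} [MeasurableSpace Ω] {P : Measure Ω} [IsProbabilityMeasure P]
    {Y : Ω → ℝ} (hY : Measurable Y) {b v lam : ℝ} (hb : ∀ ω, |Y ω| ≤ b)
    (hmean : ∫ ω, Y ω ∂P = 0) (hv : ∫ ω, Y ω ^ 2 ∂P ≤ v) (hlb : |lam| * b ≤ 1) :
    mgf Y P lam ≤ Real.exp (lam ^ 2 * v) := by
  have hYi : Integrable Y P := Integrable.of_bound hY.aestronglyMeasurable b (.of_forall hb)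
  have hY2 : Integrable (fun ω => Y ω ^ 2) P :=
    Integrable.of_bound (hY.pow_const 2).aestronglyMeasurable (b ^ 2) (.of_forall fun ω => by
      rw [Real.norm_eq_abs, abs_pow]
      exact pow_le_pow_left₀ (abs_nonneg _) (hb ω) 2)
  have habs : ∀ ω, |lam * Y ω| ≤ 1 := fun ω => by
    rw [abs_mul]
    exact (mul_le_mul_of_nonneg_left (hb ω) (abs_nonneg _)).trans hlb
  -- The bound `exp t ≤ 1 + t + t ^ 2` for `|t| ≤ 1`; the linear term vanishes on integration.
  have hpt : ∀ ω, Real.exp (lam * Y ω) ≤ 1 + lam * Y ω + lam ^ 2 * Y ω ^ 2 := fun ω => by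
    have := (abs_le.1 (Real.abs_exp_sub_one_sub_id_le (habs ω))).2
    rw [mul_pow] at this
    linarith
  have hei : Integrable (fun ω => Real.exp (lam * Y ω)) P :=
    Integrable.of_bound (by fun_prop) (Real.exp 1) (.of_forall fun ω => by
      rw [Real.norm_eq_abs, Real.abs_exp]
      exact Real.exp_le_exp.2 ((le_abs_self _).trans (habs ω)))
  have h1 : Integrable (fun ω => 1 + lam * Y ω) P := (integrable_const 1).add (hYi.const_mul lam)
  calc mgf Y P lam ≤ ∫ ω, (1 + lam * Y ω + lam ^ 2 * Y ω ^ 2) ∂P :=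
        integral_mono hei (h1.add (hY2.const_mul _)) hpt
    _ = 1 + lam ^ 2 * ∫ ω, Y ω ^ 2 ∂P := by
        rw [integral_add h1 (hY2.const_mul _), integral_add (integrable_const 1)
          (hYi.const_mul lam), integral_const_mul, integral_const_mul, hmean]
        simp
    _ ≤ 1 + lam ^ 2 * v := by gcongr
    _ ≤ Real.exp (lam ^ 2 * v) := by linarith [Real.add_one_le_exp (lam ^ 2 * v)]

theorem measure_sum_ge_le {Ω : Type*} [MeasurableSpace Ω] {P : Measure Ω} [IsProbabilityMeasure P]
    {Y : ℕ → Ω → ℝ} (hY : ∀ j, Measurable (Y j)) (hind : iIndepFun Y P) {b v lam u : ℝ}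
    (hb : ∀ j ω, |Y j ω| ≤ b) (hmean : ∀ j, ∫ ω, Y j ω ∂P = 0)
    (hv : ∀ j, ∫ ω, Y j ω ^ 2 ∂P ≤ v) (hlam : 0 ≤ lam) (hlb : lam * b ≤ 1) (n : ℕ) :
    P.real {ω | u ≤ ∑ j ∈ Finset.range n, Y j ω} ≤ Real.exp (-lam * u + n * (lam ^ 2 * v)) := by
  have hbd : ∀ ω, |lam * ∑ j ∈ Finset.range n, Y j ω| ≤ lam * (n * b) := fun ω => by
    rw [abs_mul, abs_of_nonneg hlam]
    refine mul_le_mul_of_nonneg_left ((Finset.abs_sum_le_sum_abs _ _).trans ?_) hlam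
    refine (Finset.sum_le_sum fun j _ => hb j ω).trans ?_
    simp
  have hei : Integrable (fun ω => Real.exp (lam * (∑ j ∈ Finset.range n, Y j) ω)) P :=
    Integrable.of_bound (by fun_prop) (Real.exp (lam * (n * b))) (.of_forall fun ω => by
      rw [Real.norm_eq_abs, Real.abs_exp, Finset.sum_apply]
      exact Real.exp_le_exp.2 ((le_abs_self _).trans (hbd ω)))
  have h := measure_ge_le_exp_mul_mgf (μ := P) u hlam hei
  simp only [Finset.sum_apply] at h
  refine h.trans ?_
  rw [Real.exp_add]
  refine mul_le_mul_of_nonneg_left ?_ (Real.exp_nonneg _)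
  rw [hind.mgf_sum hY (Finset.range n)]
  calc ∏ j ∈ Finset.range n, mgf (Y j) P lam
      ≤ ∏ j ∈ Finset.range n, Real.exp (lam ^ 2 * v) :=
        Finset.prod_le_prod (fun j _ => mgf_nonneg) fun j _ =>
          mgf_le_of_abs_le (hY j) (hb j) (hmean j) (hv j) (by rwa [abs_of_nonneg hlam])
    _ = Real.exp (n * (lam ^ 2 * v)) := by
        rw [Finset.prod_const, Finset.card_range, ← Real.exp_nat_mul]

/-- A Bernstein type inequality. -/
theorem measure_abs_sum_ge_le {Ω : Type*} [MeasurableSpace Ω] {P : Measure Ω}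
    [IsProbabilityMeasure P]
    {Y : ℕ → Ω → ℝ} (hY : ∀ j, Measurable (Y j)) (hind : iIndepFun Y P) {b v lam u : ℝ}
    (hb : ∀ j ω, |Y j ω| ≤ b) (hmean : ∀ j, ∫ ω, Y j ω ∂P = 0)
    (hv : ∀ j, ∫ ω, Y j ω ^ 2 ∂P ≤ v) (hlam : 0 ≤ lam) (hlb : lam * b ≤ 1) (n : ℕ) :
    P {ω | u ≤ |∑ j ∈ Finset.range n, Y j ω|} ≤
      ENNReal.ofReal (2 * Real.exp (-lam * u + n * (lam ^ 2 * v))) := by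
  have h1 := measure_sum_ge_le (u := u) hY hind hb hmean hv hlam hlb n
  have h2 := measure_sum_ge_le (u := u) (Y := fun j ω => - Y j ω) (fun j => (hY j).neg)
    (hind.comp (fun _ y => - y) fun _ => measurable_neg) (b := b) (v := v) (lam := lam)
    (fun j ω => by simpa using hb j ω) (fun j => by rw [integral_neg, hmean j, neg_zero])
    (fun j => by simpa using hv j) hlam hlb n
  have hsub : {ω | u ≤ |∑ j ∈ Finset.range n, Y j ω|} ⊆
      {ω | u ≤ ∑ j ∈ Finset.range n, Y j ω} ∪ {ω | u ≤ ∑ j ∈ Finset.range n, - Y j ω} := by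
    intro ω hω
    rcases le_abs.1 (show u ≤ |∑ j ∈ Finset.range n, Y j ω| from hω) with h | h
    · exact Or.inl h
    · exact Or.inr (by simpa using h)
  rw [← ofReal_measureReal]
  refine ENNReal.ofReal_le_ofReal ?_
  calc _ ≤ _ := measureReal_mono hsub
    _ ≤ _ := measureReal_union_le _ _
    _ ≤ _ := by linarith

/-! ### Truncation and deviation of kernel weighted means at a point -/

/-- `φ` is bounded by `B`, Lipschitz with constant `L`, and vanishes outside `[-1, 1]`. -/
structure IsLipschitzBump (φ : ℝ → ℝ) (L B : ℝ) : Prop where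
  lipschitz : ∀ s t, |φ s - φ t| ≤ L * |s - t|
  bounded : ∀ t, |φ t| ≤ B
  support : ∀ t, t ∉ Set.Icc (-1 : ℝ) 1 → φ t = 0

theorem IsLipschitzBump.lipschitz_nonneg {φ : ℝ → ℝ} {L B : ℝ} (h : IsLipschitzBump φ L B) :
    0 ≤ L := by
  have := (abs_nonneg _).trans (h.lipschitz 1 0)
  simpa using this

theorem IsLipschitzBump.bound_nonneg {φ : ℝ → ℝ} {L B : ℝ} (h : IsLipschitzBump φ L B) :
    0 ≤ B := (abs_nonneg _).trans (h.bounded 0)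

theorem IsLipschitzBump.continuous {φ : ℝ → ℝ} {L B : ℝ} (h : IsLipschitzBump φ L B) :
    Continuous φ := by
  have : LipschitzWith L.toNNReal φ := LipschitzWith.of_dist_le_mul fun s t => by
    rw [Real.dist_eq, Real.dist_eq, Real.coe_toNNReal _ h.lipschitz_nonneg]
    exact h.lipschitz s t
  exact this.continuous

/-- Independent pairs `(Z j, η j)` with independent components, `Z j` with density `g`, and `η j`
identically distributed with a finite absolute moment of order `β`. -/
structure IsSample {Ω : Type*} [MeasurableSpace Ω] (P : Measure Ω) (Z η : ℕ → Ω → ℝ) (g : ℝ → ℝ)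
    (β : ℝ) : Prop where
  measurable_Z : ∀ j, Measurable (Z j)
  measurable_η : ∀ j, Measurable (η j)
  indep : iIndepFun (fun j ω => (Z j ω, η j ω)) P
  indep_pair : ∀ j, IndepFun (Z j) (η j) P
  density : ∀ j, P.map (Z j) = volume.withDensity fun z => ENNReal.ofReal (g z)
  identDistrib : ∀ j, IdentDistrib (η j) (η 0) P P
  integrable : Integrable (fun ω => |η 0 ω| ^ β) P

/-- The kernel weighted mean of `η j`, `j < n`, at `x`. -/
noncomputable def kernelMean (φ : ℝ → ℝ) (c : ℝ) (n : ℕ) (Z η : ℕ → ℝ) (x : ℝ) : ℝ :=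
  1 / (n : ℝ) * ∑ j ∈ Finset.range n, 1 / c * φ ((Z j - x) / c) * η j

/-- Truncation at level `τ`. -/
noncomputable def trunc (τ y : ℝ) : ℝ := if |y| ≤ τ then y else 0

theorem measurable_trunc (τ : ℝ) : Measurable (trunc τ) :=
  Measurable.ite (measurableSet_le (by fun_prop) measurable_const) measurable_id measurable_const

theorem abs_trunc_le {τ : ℝ} (hτ : 0 ≤ τ) (y : ℝ) : |trunc τ y| ≤ τ := by
  unfold trunc; split_ifs with h
  · exact h
  · simpa using hτ

theorem abs_trunc_le_abs (τ y : ℝ) : |trunc τ y| ≤ |y| := by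
  unfold trunc; split_ifs with h
  · exact le_rfl
  · simp

/-- Where truncation acts, `|y| > τ`, so `|y| ^ (1 - β) ≤ τ ^ (1 - β)`. Integrated, this bounds the
bias of truncation by the moment of order `β`. -/
theorem abs_trunc_sub_le {τ β : ℝ} (hτ : 0 < τ) (hβ : 1 ≤ β) (y : ℝ) :
    |trunc τ y - y| ≤ τ ^ (1 - β) * |y| ^ β := by
  unfold trunc; split_ifs with h
  · simp only [sub_self, abs_zero]; positivity
  · have hy : 0 < |y| := hτ.trans (not_le.1 h)
    rw [zero_sub, abs_neg]
    have h1 : τ ^ (β - 1) ≤ |y| ^ (β - 1) :=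
      Real.rpow_le_rpow hτ.le (not_le.1 h).le (by linarith)
    have h2 : |y| ^ β = |y| ^ (β - 1) * |y| := by
      rw [← Real.rpow_add_one hy.ne']; ring_nf
    have h3 : τ ^ (1 - β) * τ ^ (β - 1) = 1 := by
      rw [← Real.rpow_add hτ]; simp
    calc |y| = τ ^ (1 - β) * τ ^ (β - 1) * |y| := by rw [h3, one_mul]
      _ ≤ τ ^ (1 - β) * |y| ^ (β - 1) * |y| := by gcongr
      _ = _ := by rw [h2, mul_assoc]

theorem sq_le_one_add_rpow {β : ℝ} (hβ : 2 ≤ β) (y : ℝ) : y ^ 2 ≤ 1 + |y| ^ β := by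
  rcases le_total |y| 1 with h | h
  · have : |y| ^ 2 ≤ 1 := pow_le_one₀ (abs_nonneg _) h
    rw [sq_abs] at this
    have := Real.rpow_nonneg (abs_nonneg y) β
    linarith
  · have : |y| ^ (2 : ℝ) ≤ |y| ^ β := Real.rpow_le_rpow_of_exponent_le h hβ
    rw [Real.rpow_two, sq_abs] at this
    linarith

section

variable {Ω : Type*} [MeasurableSpace Ω] {P : Measure Ω} {Z η : ℕ → Ω → ℝ} {g : ℝ → ℝ} {β : ℝ}

theorem IsSample.integrable_rpow (h : IsSample P Z η g β) (j : ℕ) :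
    Integrable (fun ω => |η j ω| ^ β) P :=
  ((h.identDistrib j).comp (u := fun y => |y| ^ β) (by fun_prop)).integrable_iff.2 h.integrable

theorem IsSample.integral_rpow (h : IsSample P Z η g β) (j : ℕ) :
    ∫ ω, |η j ω| ^ β ∂P = ∫ ω, |η 0 ω| ^ β ∂P :=
  ((h.identDistrib j).comp (u := fun y => |y| ^ β) (by fun_prop)).integral_eq

theorem IsSample.integrable_η [IsProbabilityMeasure P] (h : IsSample P Z η g β) (hβ : 2 ≤ β) (j : ℕ) :
    Integrable (η j) P := by
  refine ((integrable_const (2 : ℝ)).add (h.integrable_rpow j)).mono'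
    (h.measurable_η j).aestronglyMeasurable (.of_forall fun ω => ?_)
  have h1 := sq_le_one_add_rpow hβ (η j ω)
  rw [Real.norm_eq_abs]
  simp only [Pi.add_apply]
  nlinarith [sq_abs (η j ω), sq_nonneg (|η j ω| - 1)]

theorem IsSample.measure_Icc_le (h : IsSample P Z η g β) {Cg : ℝ} (hg : ∀ x, g x ≤ Cg)
    (j : ℕ) (x c : ℝ) :
    P {ω | Z j ω ∈ Set.Icc (x - c) (x + c)} ≤ ENNReal.ofReal (Cg * (2 * c)) := by
  have h0 : P {ω | Z j ω ∈ Set.Icc (x - c) (x + c)} = P.map (Z j) (Set.Icc (x - c) (x + c)) := by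
    rw [Measure.map_apply (h.measurable_Z j) measurableSet_Icc]; rfl
  rw [h0, h.density j, withDensity_apply _ measurableSet_Icc]
  calc ∫⁻ z in Set.Icc (x - c) (x + c), ENNReal.ofReal (g z)
      ≤ ∫⁻ z in Set.Icc (x - c) (x + c), ENNReal.ofReal Cg :=
        lintegral_mono fun z => ENNReal.ofReal_le_ofReal (hg z)
    _ = ENNReal.ofReal Cg * ENNReal.ofReal (2 * c) := by
        rw [setLIntegral_const, Real.volume_Icc]; congr 2; ring
    _ ≤ _ := by
        rcases le_total 0 Cg with hC | hC
        · rw [ENNReal.ofReal_mul hC]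
        · rw [ENNReal.ofReal_of_nonpos hC]; simp

/-- The window around `x` has length `2 * c`, hence probability of order `c`. This factor brings the
variance of a summand from `1 / c ^ 2` down to order `1 / c`. -/
theorem IsSample.integral_comp_le [IsProbabilityMeasure P] (h : IsSample P Z η g β) {Cg : ℝ} (hCg : 0 ≤ Cg)
    (hg : ∀ x, g x ≤ Cg) {ψ : ℝ → ℝ} (hψm : Measurable ψ) {B : ℝ} (hB : ∀ t, |ψ t| ≤ B)
    (hsupp : ∀ t, t ∉ Set.Icc (-1 : ℝ) 1 → ψ t = 0) {c : ℝ} (hc : 0 < c) (j : ℕ) (x : ℝ) :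
    ∫ ω, ψ ((Z j ω - x) / c) ∂P ≤ 2 * B * Cg * c := by
  have hB0 : 0 ≤ B := (abs_nonneg _).trans (hB 0)
  have hZm := h.measurable_Z j
  set s : Set Ω := {ω | Z j ω ∈ Set.Icc (x - c) (x + c)} with hs
  have hsm : MeasurableSet s := hZm measurableSet_Icc
  have hle : ∀ ω, ψ ((Z j ω - x) / c) ≤ s.indicator (fun _ => B) ω := fun ω => by
    by_cases hω : ω ∈ s
    · rw [Set.indicator_of_mem hω]; exact (le_abs_self _).trans (hB _)
    · rw [Set.indicator_of_notMem hω, hsupp]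
      contrapose! hω
      obtain ⟨h1, h2⟩ := hω
      rw [le_div_iff₀ hc] at h1
      rw [div_le_iff₀ hc] at h2
      exact ⟨by linarith, by linarith⟩
  have hi : Integrable (fun ω => ψ ((Z j ω - x) / c)) P :=
    Integrable.of_bound (hψm.comp (by fun_prop)).aestronglyMeasurable B
      (.of_forall fun ω => hB _)
  calc ∫ ω, ψ ((Z j ω - x) / c) ∂P ≤ ∫ ω, s.indicator (fun _ => B) ω ∂P :=
        integral_mono hi ((integrable_const B).indicator hsm) hle
    _ = P.real s * B := by
        rw [integral_indicator hsm, setIntegral_const, smul_eq_mul]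
    _ ≤ (Cg * (2 * c)) * B := by
        refine mul_le_mul_of_nonneg_right ?_ hB0
        exact ENNReal.toReal_le_of_le_ofReal (by positivity) (h.measure_Icc_le hg j x c)
    _ = _ := by ring

variable {φ : ℝ → ℝ} {L B : ℝ} {c : ℝ}

theorem abs_kernel_mul_le (hφ : IsLipschitzBump φ L B) (hc : 0 < c) (x z y : ℝ) :
    |1 / c * φ ((z - x) / c) * y| ≤ B / c * |y| := by
  rw [abs_mul, abs_mul, abs_of_pos (by positivity : 0 < 1 / c)]
  have := hφ.bounded ((z - x) / c)
  have hc' : 0 ≤ 1 / c := by positivity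
  calc 1 / c * |φ ((z - x) / c)| * |y| ≤ 1 / c * B * |y| := by gcongr
    _ = _ := by ring

theorem abs_kernel_mul_sub_le (hφ : IsLipschitzBump φ L B) (hc : 0 < c) (x x' z y : ℝ) :
    |1 / c * φ ((z - x) / c) * y - 1 / c * φ ((z - x') / c) * y| ≤ L / c ^ 2 * |x - x'| * |y| := by
  have h1 : 1 / c * φ ((z - x) / c) * y - 1 / c * φ ((z - x') / c) * y
      = 1 / c * (φ ((z - x) / c) - φ ((z - x') / c)) * y := by ring
  rw [h1, abs_mul, abs_mul, abs_of_pos (by positivity : 0 < 1 / c)]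
  have h2 := hφ.lipschitz ((z - x) / c) ((z - x') / c)
  have h3 : (z - x) / c - (z - x') / c = (x' - x) / c := by ring
  rw [h3, abs_div, abs_of_pos hc, abs_sub_comm x' x] at h2
  calc 1 / c * |φ ((z - x) / c) - φ ((z - x') / c)| * |y|
      ≤ 1 / c * (L * (|x - x'| / c)) * |y| := by gcongr
    _ = _ := by field_simp

theorem abs_kernelMean_sub_le (hφ : IsLipschitzBump φ L B) (hc : 0 < c) (n : ℕ) (Z η : ℕ → ℝ)
    {τ : ℝ} (hη : ∀ j, |η j| ≤ τ) (x x' : ℝ) :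
    |kernelMean φ c n Z η x - kernelMean φ c n Z η x'| ≤ L * τ / c ^ 2 * |x - x'| := by
  have hτ : 0 ≤ τ := (abs_nonneg _).trans (hη 0)
  have hL := hφ.lipschitz_nonneg
  rcases Nat.eq_zero_or_pos n with rfl | hn
  · simp only [kernelMean, Finset.range_zero, Finset.sum_empty, mul_zero, sub_self, abs_zero]
    positivity
  have hn' : (0 : ℝ) < n := by exact_mod_cast hn
  rw [kernelMean, kernelMean, ← mul_sub, ← Finset.sum_sub_distrib, abs_mul,
    abs_of_pos (by positivity : 0 < 1 / (n : ℝ))]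
  calc _ ≤ 1 / (n : ℝ) * ∑ j ∈ Finset.range n, L / c ^ 2 * |x - x'| * τ := by
        gcongr
        refine (Finset.abs_sum_le_sum_abs _ _).trans (Finset.sum_le_sum fun j _ => ?_)
        refine (abs_kernel_mul_sub_le hφ hc x x' (Z j) (η j)).trans ?_
        gcongr
        exact hη j
    _ = _ := by
        rw [Finset.sum_const, Finset.card_range, nsmul_eq_mul]
        field_simp

theorem measurable_kernelMean_term (hφ : IsLipschitzBump φ L B) {z y : Ω → ℝ} (hz : Measurable z)
    (hy : Measurable y) (x c : ℝ) : Measurable fun ω => 1 / c * φ ((z ω - x) / c) * y ω := by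
  have := hφ.continuous.measurable
  fun_prop

theorem integrable_kernelMean_term (hφ : IsLipschitzBump φ L B) (hc : 0 < c) {z y : Ω → ℝ}
    (hz : Measurable z) (hy : Measurable y) (hyi : Integrable y P) (x : ℝ) :
    Integrable (fun ω => 1 / c * φ ((z ω - x) / c) * y ω) P :=
  (hyi.abs.const_mul (B / c)).mono' (measurable_kernelMean_term hφ hz hy x c).aestronglyMeasurable
    (.of_forall fun ω => abs_kernel_mul_le hφ hc x (z ω) (y ω))

theorem integrable_kernelMean (hφ : IsLipschitzBump φ L B) (hc : 0 < c) {Z η : ℕ → Ω → ℝ}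
    (hz : ∀ j, Measurable (Z j)) (hy : ∀ j, Measurable (η j)) (hyi : ∀ j, Integrable (η j) P)
    (n : ℕ) (x : ℝ) :
    Integrable (fun ω => kernelMean φ c n (fun j => Z j ω) (fun j => η j ω) x) P :=
  (integrable_finsetSum _ fun j _ =>
    integrable_kernelMean_term hφ hc (hz j) (hy j) (hyi j) x).const_mul _

theorem integral_kernelMean (hφ : IsLipschitzBump φ L B) (hc : 0 < c) {Z η : ℕ → Ω → ℝ}
    (hz : ∀ j, Measurable (Z j)) (hy : ∀ j, Measurable (η j)) (hyi : ∀ j, Integrable (η j) P)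
    (n : ℕ) (x : ℝ) :
    ∫ ω, kernelMean φ c n (fun j => Z j ω) (fun j => η j ω) x ∂P
      = 1 / (n : ℝ) * ∑ j ∈ Finset.range n, ∫ ω, 1 / c * φ ((Z j ω - x) / c) * η j ω ∂P := by
  unfold kernelMean
  rw [integral_const_mul, integral_finsetSum _ fun j _ =>
    integrable_kernelMean_term hφ hc (hz j) (hy j) (hyi j) x]

/-- The deviation bound at a single point, for truncated `η`. -/
theorem IsSample.measure_kernelMean_trunc_le [IsProbabilityMeasure P] (h : IsSample P Z η g β) (hβ : 2 ≤ β) {Cg : ℝ}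
    (hCg : 0 ≤ Cg) (hg : ∀ x, g x ≤ Cg) (hφ : IsLipschitzBump φ L B) (hc : 0 < c) {τ : ℝ}
    (hτ : 0 ≤ τ) {lam : ℝ} (hlam : 0 ≤ lam) (hlb : lam * (2 * B * τ / c) ≤ 1) (t : ℝ) {n : ℕ}
    (hn : 0 < n) (x : ℝ) :
    P {ω | t ≤ |kernelMean φ c n (fun j => Z j ω) (fun j => trunc τ (η j ω)) x
        - ∫ ω', kernelMean φ c n (fun j => Z j ω') (fun j => trunc τ (η j ω')) x ∂P|} ≤
      ENNReal.ofReal (2 * Real.exp (-lam * (n * t) + n * (lam ^ 2 *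
        (2 * B ^ 2 * Cg * (1 + ∫ ω, |η 0 ω| ^ β ∂P) / c)))) := by
  have hB := hφ.bound_nonneg
  have hn' : (0 : ℝ) < n := by exact_mod_cast hn
  have htm : ∀ j, Measurable fun ω => trunc τ (η j ω) := fun j =>
    (measurable_trunc τ).comp (h.measurable_η j)
  have hti : ∀ j, Integrable (fun ω => trunc τ (η j ω)) P := fun j =>
    Integrable.of_bound (htm j).aestronglyMeasurable τ (.of_forall fun ω => abs_trunc_le hτ _)
  set X : ℕ → Ω → ℝ := fun j ω => 1 / c * φ ((Z j ω - x) / c) * trunc τ (η j ω) with hX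
  have hXm : ∀ j, Measurable (X j) := fun j =>
    measurable_kernelMean_term hφ (h.measurable_Z j) (htm j) x c
  have hXi : ∀ j, Integrable (X j) P := fun j =>
    integrable_kernelMean_term hφ hc (h.measurable_Z j) (htm j) (hti j) x
  have hXb : ∀ j ω, |X j ω| ≤ B * τ / c := fun j ω => by
    refine (abs_kernel_mul_le hφ hc x (Z j ω) _).trans ?_
    calc _ ≤ B / c * τ := by gcongr; exact abs_trunc_le hτ _
      _ = _ := by ring
  have hX2i : ∀ j, Integrable (fun ω => X j ω ^ 2) P := fun j =>
    Integrable.of_bound ((hXm j).pow_const 2).aestronglyMeasurable ((B * τ / c) ^ 2)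
      (.of_forall fun ω => by
        rw [Real.norm_eq_abs, abs_pow]
        exact pow_le_pow_left₀ (abs_nonneg _) (hXb j ω) 2)
  set Y : ℕ → Ω → ℝ := fun j ω => X j ω - ∫ ω', X j ω' ∂P with hY
  have hmeanb : ∀ j, |∫ ω', X j ω' ∂P| ≤ B * τ / c := fun j => by
    have := norm_integral_le_of_norm_le_const (μ := P) (f := X j) (C := B * τ / c)
      (.of_forall fun ω => hXb j ω)
    simpa using this
  have hYv : ∀ j, ∫ ω, Y j ω ^ 2 ∂P ≤ 2 * B ^ 2 * Cg * (1 + ∫ ω, |η 0 ω| ^ β ∂P) / c := fun j => by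
    have h1 : ∫ ω, Y j ω ^ 2 ∂P ≤ ∫ ω, X j ω ^ 2 ∂P := by
      have e : ∀ ω, Y j ω ^ 2 = X j ω ^ 2 - 2 * (∫ ω', X j ω' ∂P) * X j ω
          + (∫ ω', X j ω' ∂P) ^ 2 := fun ω => by simp only [hY]; ring
      have hs : Integrable (fun ω => X j ω ^ 2 - 2 * (∫ ω', X j ω' ∂P) * X j ω) P :=
        (hX2i j).sub ((hXi j).const_mul _)
      simp_rw [e]
      rw [integral_add hs (integrable_const _), integral_sub (hX2i j) ((hXi j).const_mul _), integral_const_mul]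
      simp only [integral_const, probReal_univ, smul_eq_mul, one_mul]
      nlinarith [sq_nonneg (∫ ω', X j ω' ∂P)]
    refine h1.trans ?_
    -- Independence of `Z j` and `η j` splits the second moment into a kernel factor of order `1 /
    -- c` and a factor bounded by the `β`-moment, uniformly in `τ`.
    have hind : IndepFun (fun ω => (1 / c * φ ((Z j ω - x) / c)) ^ 2)
        (fun ω => trunc τ (η j ω) ^ 2) P :=
      (h.indep_pair j).comp (φ := fun z => (1 / c * φ ((z - x) / c)) ^ 2)
        (ψ := fun y => trunc τ y ^ 2)
        (by have := hφ.continuous.measurable; fun_prop) ((measurable_trunc τ).pow_const 2)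
    have e2 : ∫ ω, X j ω ^ 2 ∂P = (∫ ω, (1 / c * φ ((Z j ω - x) / c)) ^ 2 ∂P)
        * ∫ ω, trunc τ (η j ω) ^ 2 ∂P := by
      rw [← hind.integral_fun_mul_eq_mul_integral
        (by
          have := hφ.continuous.measurable
          have := h.measurable_Z j
          exact Measurable.aestronglyMeasurable (by fun_prop))
        ((htm j).pow_const 2).aestronglyMeasurable]
      refine integral_congr_ae (.of_forall fun ω => ?_)
      simp only [hX]; ring
    have h3 : ∫ ω, (1 / c * φ ((Z j ω - x) / c)) ^ 2 ∂P ≤ 2 * B ^ 2 * Cg / c := by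
      have e3 : ∀ ω, (1 / c * φ ((Z j ω - x) / c)) ^ 2
          = (1 / c) ^ 2 * (fun t => φ t ^ 2) ((Z j ω - x) / c) := fun ω => by ring
      simp_rw [e3]
      rw [integral_const_mul]
      have := h.integral_comp_le hCg hg (ψ := fun t => φ t ^ 2)
        (hφ.continuous.measurable.pow_const 2) (B := B ^ 2)
        (fun t => by rw [abs_pow]; exact pow_le_pow_left₀ (abs_nonneg _) (hφ.bounded t) 2)
        (fun t ht => by simp [hφ.support t ht]) hc j x
      calc _ ≤ (1 / c) ^ 2 * (2 * B ^ 2 * Cg * c) := by gcongr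
        _ = _ := by field_simp
    have h4 : ∫ ω, trunc τ (η j ω) ^ 2 ∂P ≤ 1 + ∫ ω, |η 0 ω| ^ β ∂P := by
      calc ∫ ω, trunc τ (η j ω) ^ 2 ∂P ≤ ∫ ω, (1 + |η j ω| ^ β) ∂P := by
            refine integral_mono_of_nonneg (.of_forall fun ω => sq_nonneg _)
              ((integrable_const 1).add (h.integrable_rpow j)) (.of_forall fun ω => ?_)
            refine le_trans ?_ (sq_le_one_add_rpow hβ _)
            exact sq_le_sq.2 (abs_trunc_le_abs _ _)
        _ = _ := by
            rw [integral_add (integrable_const 1) (h.integrable_rpow j), h.integral_rpow j]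
            simp
    rw [e2]
    calc _ ≤ 2 * B ^ 2 * Cg / c * (1 + ∫ ω, |η 0 ω| ^ β ∂P) :=
          mul_le_mul h3 h4 (integral_nonneg fun ω => sq_nonneg _) (by positivity)
      _ = _ := by ring
  have hYind : iIndepFun Y P :=
    h.indep.comp (fun j p => 1 / c * φ ((p.1 - x) / c) * trunc τ p.2 - ∫ ω', X j ω' ∂P)
      (fun j => by
        have := hφ.continuous.measurable
        have := measurable_trunc τ
        fun_prop)
  have key := measure_abs_sum_ge_le (u := n * t) (Y := Y) (fun j => (hXm j).sub_const _) hYind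
    (b := 2 * B * τ / c) (lam := lam)
    (fun j ω => (abs_sub _ _).trans (by
      have h1 := hXb j ω
      have h2 := hmeanb j
      calc _ ≤ B * τ / c + B * τ / c := add_le_add h1 h2
        _ = _ := by ring))
    (fun j => by
      simp only [hY]
      rw [integral_sub (hXi j) (integrable_const _)]; simp)
    hYv hlam hlb n
  refine le_trans (measure_mono fun ω hω => ?_) key
  simp only [Set.mem_ofPred_eq] at hω ⊢
  rw [integral_kernelMean hφ hc h.measurable_Z htm hti, kernelMean, ← mul_sub,
    ← Finset.sum_sub_distrib, abs_mul, abs_of_pos (by positivity : 0 < 1 / (n : ℝ))] at hω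
  rw [one_div, ← div_eq_inv_mul, le_div_iff₀ hn', mul_comm] at hω
  exact hω

end

/-! ### Uniform deviation on the unit interval for fixed parameters -/

theorem supUnit_le {h : ℝ → ℝ} {a : ℝ} (H : ∀ x ∈ Set.Icc (0 : ℝ) 1, |h x| ≤ a) :
    supUnit h ≤ ENNReal.ofReal a :=
  iSup₂_le fun x hx => ENNReal.ofReal_le_ofReal (H x hx)

theorem abs_le_of_supUnit_le {h : ℝ → ℝ} {a : ℝ} (ha : 0 ≤ a)
    (H : supUnit h ≤ ENNReal.ofReal a) {x : ℝ} (hx : x ∈ Set.Icc (0 : ℝ) 1) : |h x| ≤ a :=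
  (ENNReal.ofReal_le_ofReal_iff ha).1 ((le_iSup₂ (f := fun x (_ : x ∈ Set.Icc (0 : ℝ) 1) =>
    ENNReal.ofReal |h x|) x hx).trans H)

section

variable {Ω : Type*} [MeasurableSpace Ω] {P : Measure Ω}
  {Z η : ℕ → Ω → ℝ} {g : ℝ → ℝ} {β : ℝ} {φ : ℝ → ℝ} {L B : ℝ} {c : ℝ}

theorem IsSample.measure_lt_abs_le [IsProbabilityMeasure P] (h : IsSample P Z η g β)
    (hβ : 0 < β) {τ : ℝ} (hτ : 0 < τ) (j : ℕ) :
    P {ω | τ < |η j ω|} ≤ ENNReal.ofReal ((∫ ω, |η 0 ω| ^ β ∂P) / τ ^ β) := by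
  have h1 := mul_meas_ge_le_integral_of_nonneg (μ := P) (f := fun ω => |η j ω| ^ β)
    (.of_forall fun ω => by positivity) (h.integrable_rpow j) (τ ^ β)
  rw [h.integral_rpow j] at h1
  have hpos : 0 < τ ^ β := Real.rpow_pos_of_pos hτ β
  rw [← ofReal_measureReal]
  refine ENNReal.ofReal_le_ofReal ?_
  rw [le_div_iff₀ hpos, mul_comm]
  refine le_trans (mul_le_mul_of_nonneg_left (measureReal_mono fun ω hω => ?_) hpos.le) h1
  exact Real.rpow_le_rpow hτ.le (le_of_lt hω) hβ.le

theorem IsSample.abs_integral_trunc_sub_le [IsProbabilityMeasure P] (h : IsSample P Z η g β)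
    (hβ : 2 ≤ β) (hφ : IsLipschitzBump φ L B) (hc : 0 < c) {τ : ℝ} (hτ : 0 < τ) (n : ℕ) (x : ℝ) :
    |∫ ω, kernelMean φ c n (fun j => Z j ω) (fun j => trunc τ (η j ω)) x ∂P
      - ∫ ω, kernelMean φ c n (fun j => Z j ω) (fun j => η j ω) x ∂P| ≤
      B / c * (τ ^ (1 - β) * ∫ ω, |η 0 ω| ^ β ∂P) := by
  have hB := hφ.bound_nonneg
  have htm : ∀ j, Measurable fun ω => trunc τ (η j ω) := fun j =>
    (measurable_trunc τ).comp (h.measurable_η j)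
  have hti : ∀ j, Integrable (fun ω => trunc τ (η j ω)) P := fun j =>
    Integrable.of_bound (htm j).aestronglyMeasurable τ (.of_forall fun ω => abs_trunc_le hτ.le _)
  have hi := h.integrable_η hβ
  have hK : 0 ≤ ∫ ω, |η 0 ω| ^ β ∂P := integral_nonneg fun ω => by positivity
  rcases Nat.eq_zero_or_pos n with rfl | hn
  · simp only [kernelMean, Finset.range_zero, Finset.sum_empty, mul_zero, integral_zero, sub_self,
      abs_zero]
    positivity
  have hn' : (0 : ℝ) < n := by exact_mod_cast hn
  rw [integral_kernelMean hφ hc h.measurable_Z htm hti,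
    integral_kernelMean hφ hc h.measurable_Z h.measurable_η hi, ← mul_sub,
    ← Finset.sum_sub_distrib, abs_mul, abs_of_pos (by positivity : 0 < 1 / (n : ℝ))]
  have hterm : ∀ j, |∫ ω, 1 / c * φ ((Z j ω - x) / c) * trunc τ (η j ω) ∂P
      - ∫ ω, 1 / c * φ ((Z j ω - x) / c) * η j ω ∂P|
      ≤ B / c * (τ ^ (1 - β) * ∫ ω, |η 0 ω| ^ β ∂P) := fun j => by
    rw [← integral_sub
      (integrable_kernelMean_term hφ hc (h.measurable_Z j) (htm j) (hti j) x)
      (integrable_kernelMean_term hφ hc (h.measurable_Z j) (h.measurable_η j) (hi j) x)]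
    refine (abs_integral_le_integral_abs).trans ?_
    calc _ ≤ ∫ ω, B / c * (τ ^ (1 - β) * |η j ω| ^ β) ∂P := by
          refine integral_mono_of_nonneg (.of_forall fun ω => abs_nonneg _)
            (((h.integrable_rpow j).const_mul _).const_mul _) (.of_forall fun ω => ?_)
          simp only
          rw [← mul_sub]
          refine (abs_kernel_mul_le hφ hc x (Z j ω) _).trans ?_
          exact mul_le_mul_of_nonneg_left (abs_trunc_sub_le hτ (by linarith) _) (by positivity)
      _ = _ := by rw [integral_const_mul, integral_const_mul, h.integral_rpow j]
  calc _ ≤ 1 / (n : ℝ) * ∑ j ∈ Finset.range n, B / c * (τ ^ (1 - β) * ∫ ω, |η 0 ω| ^ β ∂P) := by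
        gcongr
        exact (Finset.abs_sum_le_sum_abs _ _).trans (Finset.sum_le_sum fun j _ => hterm j)
    _ = _ := by
        rw [Finset.sum_const, Finset.card_range, nsmul_eq_mul]
        field_simp

/-- The uniform deviation bound for fixed sample size `n`, truncation level `τ` and grid width
`1 / N`. -/
theorem IsSample.measure_supUnit_le [IsProbabilityMeasure P] (h : IsSample P Z η g β) (hβ : 2 ≤ β)
    {Cg : ℝ} (hCg : 0 ≤ Cg) (hg : ∀ x, g x ≤ Cg) (hφ : IsLipschitzBump φ L B) (hc : 0 < c) {τ : ℝ}
    (hτ : 0 < τ) {lam : ℝ} (hlam : 0 ≤ lam) (hlb : lam * (2 * B * τ / c) ≤ 1) (t : ℝ) {n N : ℕ}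
    (hn : 0 < n) (hN : 0 < N) :
    P {ω | ENNReal.ofReal (t + 2 * (L * τ / c ^ 2 * (1 / N))
          + B / c * (τ ^ (1 - β) * ∫ ω, |η 0 ω| ^ β ∂P)) <
        supUnit fun x => kernelMean φ c n (fun j => Z j ω) (fun j => η j ω) x
          - ∫ ω', kernelMean φ c n (fun j => Z j ω') (fun j => η j ω') x ∂P} ≤
      ENNReal.ofReal (n * ((∫ ω, |η 0 ω| ^ β ∂P) / τ ^ β)) +
      ENNReal.ofReal ((N + 1) * (2 * Real.exp (-lam * (n * t) + n * (lam ^ 2 *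
        (2 * B ^ 2 * Cg * (1 + ∫ ω, |η 0 ω| ^ β ∂P) / c))))) := by
  set K := ∫ ω, |η 0 ω| ^ β ∂P with hKdef
  have hK : 0 ≤ K := integral_nonneg fun ω => by positivity
  have hL := hφ.lipschitz_nonneg
  have hN' : (0 : ℝ) < N := by exact_mod_cast hN
  have htm : ∀ j, Measurable fun ω => trunc τ (η j ω) := fun j =>
    (measurable_trunc τ).comp (h.measurable_η j)
  have hti : ∀ j, Integrable (fun ω => trunc τ (η j ω)) P := fun j =>
    Integrable.of_bound (htm j).aestronglyMeasurable τ (.of_forall fun ω => abs_trunc_le hτ.le _)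
  set G : Ω → ℝ → ℝ := fun ω x => kernelMean φ c n (fun j => Z j ω) (fun j => trunc τ (η j ω)) x
    with hG
  have hGi : ∀ x, Integrable (fun ω => G ω x) P := fun x =>
    integrable_kernelMean hφ hc h.measurable_Z htm hti n x
  have hGL : ∀ ω x x', |G ω x - G ω x'| ≤ L * τ / c ^ 2 * |x - x'| := fun ω x x' =>
    abs_kernelMean_sub_le hφ hc n _ _ (fun j => abs_trunc_le hτ.le _) x x'
  have hEL : ∀ x x', |∫ ω, G ω x ∂P - ∫ ω, G ω x' ∂P| ≤ L * τ / c ^ 2 * |x - x'| := fun x x' => by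
    rw [← integral_sub (hGi x) (hGi x')]
    have := norm_integral_le_of_norm_le_const (μ := P) (f := fun ω => G ω x - G ω x')
      (.of_forall fun ω => hGL ω x x')
    simpa using this
  have hsub : {ω | ENNReal.ofReal (t + 2 * (L * τ / c ^ 2 * (1 / N)) + B / c * (τ ^ (1 - β) * K)) <
        supUnit fun x => kernelMean φ c n (fun j => Z j ω) (fun j => η j ω) x
          - ∫ ω', kernelMean φ c n (fun j => Z j ω') (fun j => η j ω') x ∂P} ⊆
      (⋃ j ∈ Finset.range n, {ω | τ < |η j ω|}) ∪
      ⋃ k ∈ Finset.range (N + 1), {ω | t ≤ |G ω (k / N) - ∫ ω', G ω' (k / N) ∂P|} := by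
    -- Off both events `η` agrees with its truncation for `j < n`, and the deviation at each grid
    -- point is below `t`. Moving `x` to the grid costs the Lipschitz bound twice, for the mean and
    -- for its expectation; undoing the truncation in the expectation costs its bias.
    intro ω hω
    by_contra hcon
    simp only [Set.mem_union, Set.mem_iUnion, Set.mem_ofPred_eq, not_or, not_exists, not_lt,
      not_le] at hcon
    obtain ⟨h1, h2⟩ := hcon
    refine absurd hω (not_lt.2 (supUnit_le fun x hx => ?_))
    have hGeq : kernelMean φ c n (fun j => Z j ω) (fun j => η j ω) x = G ω x := by
      simp only [hG, kernelMean]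
      congr 1
      refine Finset.sum_congr rfl fun j hj => ?_
      rw [trunc, if_pos (h1 j hj)]
    -- The grid point just left of `x`; `x = 1` gives `k = N`, hence `N + 1` points.
    set k : ℕ := ⌊x * N⌋₊ with hk
    have hk1 : (k : ℝ) ≤ x * N := Nat.floor_le (by have := hx.1; positivity)
    have hk2 : x * N < k + 1 := Nat.lt_floor_add_one _
    have hkN : k ∈ Finset.range (N + 1) := by
      rw [Finset.mem_range, Nat.lt_succ_iff]
      have : (k : ℝ) ≤ N := hk1.trans (by nlinarith [hx.2])
      exact_mod_cast this
    have hxk : |x - k / N| ≤ 1 / N := by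
      rw [abs_of_nonneg (by rw [sub_nonneg, div_le_iff₀ hN']; exact hk1), sub_le_iff_le_add,
        ← add_div, le_div_iff₀ hN']
      linarith
    have a1 := h2 k hkN
    have hLc : 0 ≤ L * τ / c ^ 2 := by positivity
    have a2 := (hGL ω x (k / N)).trans (mul_le_mul_of_nonneg_left hxk hLc)
    have a3 := (hEL x (k / N)).trans (mul_le_mul_of_nonneg_left hxk hLc)
    have a4 := h.abs_integral_trunc_sub_le hβ hφ hc hτ n x
    rw [hGeq]
    rw [abs_lt] at a1
    rw [abs_le] at a2 a3 a4 ⊢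
    simp only [hG] at a1 a2 a3 a4 ⊢
    constructor <;> linarith [a1.1, a1.2, a2.1, a2.2, a3.1, a3.2, a4.1, a4.2]
  refine (measure_mono hsub).trans ((measure_union_le _ _).trans (add_le_add ?_ ?_))
  · refine (measure_biUnion_finset_le _ _).trans ?_
    refine (Finset.sum_le_sum fun j _ => h.measure_lt_abs_le (by linarith) hτ j).trans ?_
    rw [Finset.sum_const, Finset.card_range, nsmul_eq_mul, ENNReal.ofReal_mul (by positivity),
      ENNReal.ofReal_natCast]
  · refine (measure_biUnion_finset_le _ _).trans ?_
    refine (Finset.sum_le_sum fun k _ => h.measure_kernelMean_trunc_le hβ hCg hg hφ hc hτ.le hlam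
      hlb t hn _).trans ?_
    rw [Finset.sum_const, Finset.card_range, nsmul_eq_mul,
      ENNReal.ofReal_mul (p := (N : ℝ) + 1) (by positivity)]
    refine le_of_eq ?_
    congr 1
    rw [← Nat.cast_succ, ENNReal.ofReal_natCast]

end

/-! ### The rate, and the choice of truncation level, grid and exponent -/

/-- The uniform rate `(n c / log n)^(-1/2)`. -/
noncomputable def rate (c : ℕ → ℝ) (n : ℕ) : ℝ := ((n : ℝ) * c n / Real.log n) ^ (-(1 / 2) : ℝ)

theorem eventually_one_le_log : ∀ᶠ n : ℕ in atTop, 1 ≤ Real.log n :=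
  (Real.tendsto_log_atTop.comp tendsto_natCast_atTop_atTop).eventually_ge_atTop 1

theorem rate_pos {c : ℕ → ℝ} (hc : ∀ n, 0 < c n) {n : ℕ} (hn : 0 < n) (hl : 1 ≤ Real.log n) :
    0 < rate c n := by
  have : (0 : ℝ) < n := by exact_mod_cast hn
  have := hc n
  exact Real.rpow_pos_of_pos (by positivity) _

theorem rate_sq {c : ℕ → ℝ} (hc : ∀ n, 0 < c n) {n : ℕ} (hn : 0 < n) (hl : 1 ≤ Real.log n) :
    rate c n ^ 2 = Real.log n / (n * c n) := by
  have : (0 : ℝ) < n := by exact_mod_cast hn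
  have := hc n
  have h0 : 0 < (n : ℝ) * c n / Real.log n := by positivity
  rw [rate, ← Real.rpow_natCast, ← Real.rpow_mul h0.le]
  norm_num
  rw [Real.rpow_neg_one, inv_div]

/-- The square of the left side is `log n / n` times `c⁻¹ * n ^ (2 / β)`. The bandwidth condition
enters the estimates through this bound. -/
theorem exists_rate_mul_le {c : ℕ → ℝ} (hc : ∀ n, 0 < c n) {β : ℝ}
    (hcβ : (fun n : ℕ => (c n)⁻¹ * (n : ℝ) ^ (2 / β))
      =O[atTop] fun n : ℕ => (n : ℝ) / Real.log n) :
    ∃ K : ℝ, 0 < K ∧ ∀ᶠ n : ℕ in atTop, rate c n * (n : ℝ) ^ (1 / β) ≤ K := by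
  obtain ⟨K, hK, hb⟩ := hcβ.exists_pos
  refine ⟨K + 1, by linarith, ?_⟩
  filter_upwards [hb.bound, eventually_one_le_log, eventually_gt_atTop 0] with n h1 hl hn
  have hn' : (0 : ℝ) < n := by exact_mod_cast hn
  have hcn := hc n
  rw [Real.norm_of_nonneg (by positivity), Real.norm_of_nonneg (by positivity)] at h1
  have hsq : (rate c n * (n : ℝ) ^ (1 / β)) ^ 2 ≤ K := by
    have e : ((n : ℝ) ^ (1 / β)) ^ 2 = (n : ℝ) ^ (2 / β) := by
      rw [← Real.rpow_natCast, ← Real.rpow_mul hn'.le]; congr 1; push_cast; ring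
    rw [mul_pow, rate_sq hc hn hl, e]
    calc Real.log n / (n * c n) * (n : ℝ) ^ (2 / β)
        = Real.log n / n * ((c n)⁻¹ * (n : ℝ) ^ (2 / β)) := by field_simp
      _ ≤ Real.log n / n * (K * (n / Real.log n)) := by gcongr
      _ = K := by field_simp
  nlinarith [sq_nonneg (rate c n * (n : ℝ) ^ (1 / β) - 1)]

theorem tendsto_rate {c : ℕ → ℝ} (hc : ∀ n, 0 < c n) {β : ℝ} (hβ : 0 < β)
    (hcβ : (fun n : ℕ => (c n)⁻¹ * (n : ℝ) ^ (2 / β))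
      =O[atTop] fun n : ℕ => (n : ℝ) / Real.log n) :
    Tendsto (rate c) atTop (𝓝 0) := by
  obtain ⟨K, hK, h⟩ := exists_rate_mul_le hc hcβ
  have h0 : Tendsto (fun n : ℕ => K * (n : ℝ) ^ (-(1 / β))) atTop (𝓝 0) := by
    simpa using ((tendsto_rpow_neg_atTop (by positivity : 0 < 1 / β)).comp
      tendsto_natCast_atTop_atTop).const_mul K
  refine squeeze_zero' ?_ ?_ h0
  · filter_upwards [eventually_one_le_log, eventually_gt_atTop 0] with n hl hn
    exact (rate_pos hc hn hl).le
  · filter_upwards [h, eventually_gt_atTop 0] with n h hn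
    have hn' : (0 : ℝ) < n := by exact_mod_cast hn
    rw [Real.rpow_neg hn'.le, ← div_eq_mul_inv, le_div_iff₀ (by positivity)]
    exact h

theorem exists_pos_ofReal_le {e : ℝ≥0∞} (he : 0 < e) : ∃ r : ℝ, 0 < r ∧ ENNReal.ofReal r ≤ e := by
  rcases eq_or_ne e ⊤ with rfl | h
  · exact ⟨1, one_pos, le_top⟩
  · exact ⟨e.toReal, ENNReal.toReal_pos he.ne' h, (ENNReal.ofReal_toReal h).le⟩

section

variable {Ω : Type*} [MeasurableSpace Ω] {P : Measure Ω} [IsProbabilityMeasure P]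
  {Z η : ℕ → Ω → ℝ} {g : ℝ → ℝ} {β : ℝ} {φ : ℝ → ℝ} {L B : ℝ} {c : ℕ → ℝ}

/-- Kernel weighted means deviate from their expectations, uniformly on `[0, 1]`, by
`O_p((n c / log n)^(-1/2))`. -/
theorem IsSample.isBigOP_supUnit_sub (h : IsSample P Z η g β) (hβ : 2 < β)
    {Cg : ℝ} (hg : ∀ x, g x ≤ Cg) (hφ : IsLipschitzBump φ L B) (hc : ∀ n, 0 < c n)
    (hcβ : (fun n : ℕ => (c n)⁻¹ * (n : ℝ) ^ (2 / β))
      =O[atTop] fun n : ℕ => (n : ℝ) / Real.log n) :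
    IsBigOP P (fun n ω => supUnit fun x =>
      kernelMean φ (c n) n (fun j => Z j ω) (fun j => η j ω) x
        - ∫ ω', kernelMean φ (c n) n (fun j => Z j ω') (fun j => η j ω') x ∂P) (rate c) := by
  intro e₀ he₀
  obtain ⟨e, he, hee⟩ := exists_pos_ofReal_le he₀
  have hβ0 : 0 < β := by linarith
  have hL := hφ.lipschitz_nonneg
  have hB := hφ.bound_nonneg
  wlog hCg : 0 ≤ Cg generalizing Cg
  · exact this (Cg := 0) (fun x => (hg x).trans (le_of_not_ge hCg)) le_rfl
  set K := ∫ ω, |η 0 ω| ^ β ∂P with hKdef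
  have hK : 0 ≤ K := integral_nonneg fun ω => by positivity
  obtain ⟨K₁, hK₁, hrate⟩ := exists_rate_mul_le hc hcβ
  -- The truncation level will be `(D * n) ^ (1 / β)`; by Markov, some `η j` with `j < n` exceeds it
  -- with probability at most `K / D ≤ e / 2`.
  set D : ℝ := 2 * K / e + 1 with hD
  have hDpos : 0 < D := by positivity
  set M : ℝ := D ^ (1 / β) with hM
  have hMpos : 0 < M := Real.rpow_pos_of_pos hDpos _
  have hMβ : M ^ β = D := by
    rw [hM, ← Real.rpow_mul hDpos.le, one_div, inv_mul_cancel₀ hβ0.ne', Real.rpow_one]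
  -- Small enough that `lam = κ * c n * s` satisfies the constraint `lam * b ≤ 1` of the exponential
  -- bound; the `+ 1` covers `B = 0`.
  set κ : ℝ := 1 / (2 * B * M * K₁ + 1) with hκ
  have hκpos : 0 < κ := by positivity
  set C₁ : ℝ := 2 * B ^ 2 * Cg * (1 + K) with hC₁
  have hC₁0 : 0 ≤ C₁ := by positivity
  -- Makes the exponent exactly `-3 * log n`, which outweighs the `n ^ 2 + 1` grid points.
  set L₀ : ℝ := (3 + κ ^ 2 * C₁) / κ with hL₀
  have hL₀pos : 0 < L₀ := by positivity
  have hκL : κ * L₀ = 3 + κ ^ 2 * C₁ := by rw [hL₀]; field_simp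
  refine ⟨L₀ + 2 * (L * M * K₁) + B * M / D * K * K₁, by positivity, ?_⟩
  have hsmall : ∀ᶠ n : ℕ in atTop, 4 / (n : ℝ) ≤ e / 2 :=
    (tendsto_const_div_atTop_nhds_zero_nat 4).eventually_le_const (by positivity)
  filter_upwards [hrate, eventually_one_le_log, eventually_gt_atTop 0, hsmall,
    (tendsto_rate hc hβ0 hcβ).eventually_le_const one_pos] with n hr hl hn hn4 hs1
  have hn' : (0 : ℝ) < n := by exact_mod_cast hn
  have hn1 : (1 : ℝ) ≤ n := by exact_mod_cast hn
  have hcn := hc n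
  have hspos := rate_pos hc hn hl
  have hssq := rate_sq hc hn hl
  set s := rate c n with hs
  set p : ℝ := (n : ℝ) ^ (1 / β) with hp
  have hppos : 0 < p := Real.rpow_pos_of_pos hn' _
  have hpβ : p ^ β = n := by
    rw [hp, ← Real.rpow_mul hn'.le, one_div, inv_mul_cancel₀ hβ0.ne', Real.rpow_one]
  have hncs : n * c n * s ^ 2 = Real.log n := by rw [hssq]; field_simp
  -- Because `log n ≥ 1`. Powers of `1 / c n` are traded for powers of `s` below, which shows that
  -- the grid error and the truncation bias are also `O(s)`.
  have hcinv : 1 / c n ≤ s ^ 2 * n := by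
    rw [div_le_iff₀ hcn]; linarith
  have hτpos : 0 < M * p := by positivity
  have hτβ : (M * p) ^ β = D * n := by rw [Real.mul_rpow hMpos.le hppos.le, hMβ, hpβ]
  have key := h.measure_supUnit_le hβ.le hCg hg hφ hcn hτpos (lam := κ * c n * s) (by positivity)
    (by
      calc κ * c n * s * (2 * B * (M * p) / c n) = κ * (2 * B * M * (s * p)) := by field_simp
        _ ≤ κ * (2 * B * M * K₁) := by gcongr
        _ ≤ 1 := by rw [hκ, one_div_mul_eq_div, div_le_one (by positivity)]; linarith)
    (L₀ * s) hn (N := n ^ 2) (by positivity)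
  rw [← hKdef] at key
  refine (measure_mono fun ω hω => ?_).trans (key.trans (le_trans ?_ hee))
  · refine lt_of_le_of_lt (ENNReal.ofReal_le_ofReal ?_) hω
    have hsp : s * p ≤ K₁ := hr
    have t1 : L * (M * p) / c n ^ 2 * (1 / ((n ^ 2 : ℕ) : ℝ)) ≤ L * M * K₁ * s := by
      calc L * (M * p) / c n ^ 2 * (1 / ((n ^ 2 : ℕ) : ℝ))
          = L * M * p * (1 / c n) ^ 2 / (n : ℝ) ^ 2 := by push_cast; field_simp
        _ ≤ L * M * p * (s ^ 2 * n) ^ 2 / (n : ℝ) ^ 2 := by gcongr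
        _ = L * M * (s * p) * s * s ^ 2 := by field_simp
        _ ≤ L * M * K₁ * s * 1 ^ 2 := by gcongr
        _ = _ := by ring
    have t2 : B / c n * ((M * p) ^ (1 - β) * K) ≤ B * M / D * K * K₁ * s := by
      rw [Real.rpow_sub hτpos, Real.rpow_one, hτβ]
      calc B / c n * (M * p / (D * n) * K) = B * M / D * K * p * (1 / c n) / n := by field_simp
        _ ≤ B * M / D * K * p * (s ^ 2 * n) / n := by gcongr
        _ = B * M / D * K * (s * p) * s := by field_simp
        _ ≤ _ := by gcongr
    calc _ ≤ L₀ * s + 2 * (L * M * K₁ * s) + B * M / D * K * K₁ * s := by gcongr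
      _ = _ := by ring
  · have hexp : -(κ * c n * s) * (n * (L₀ * s)) + n * ((κ * c n * s) ^ 2 * (C₁ / c n))
        = -(3 * Real.log n) := by
      calc _ = -(n * c n * s ^ 2) * (κ * L₀ - κ ^ 2 * C₁) := by field_simp; ring
        _ = _ := by rw [hκL, hncs]; ring
    rw [hexp, ← ENNReal.ofReal_add (by positivity) (by positivity)]
    refine ENNReal.ofReal_le_ofReal ?_
    have b1 : (n : ℝ) * (K / (M * p) ^ β) ≤ e / 2 := by
      rw [hτβ]
      have : (n : ℝ) * (K / (D * n)) = K / D := by field_simp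
      rw [this, div_le_iff₀ hDpos, hD]
      have : e / 2 * (2 * K / e + 1) = K + e / 2 := by field_simp
      rw [this]; linarith
    have b2 : (((n ^ 2 : ℕ) : ℝ) + 1) * (2 * Real.exp (-(3 * Real.log n))) ≤ e / 2 := by
      have e3 : Real.exp (-(3 * Real.log n)) = 1 / (n : ℝ) ^ 3 := by
        rw [Real.exp_neg, one_div]
        congr 1
        rw [show (3 : ℝ) * Real.log n = ((3 : ℕ) : ℝ) * Real.log n by norm_num,
          Real.exp_nat_mul, Real.exp_log hn']
      rw [e3]
      refine le_trans ?_ hn4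
      push_cast
      calc ((n : ℝ) ^ 2 + 1) * (2 * (1 / (n : ℝ) ^ 3))
          ≤ ((n : ℝ) ^ 2 + (n : ℝ) ^ 2) * (2 * (1 / (n : ℝ) ^ 3)) := by
            gcongr; exact one_le_pow₀ hn1
        _ = 4 / (n : ℝ) := by field_simp; norm_num
    linarith

end

/-! ### Linear systems with a coercive matrix -/

section LinearAlgebra

open Matrix

variable {ι : Type*} [Fintype ι]

theorem abs_dotProduct_le (v u : ι → ℝ) : |v ⬝ᵥ u| ≤ Fintype.card ι * (‖v‖ * ‖u‖) := by
  refine (Finset.abs_sum_le_sum_abs _ _).trans ?_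
  calc ∑ i, |v i * u i| ≤ ∑ _i : ι, ‖v‖ * ‖u‖ := Finset.sum_le_sum fun i _ => by
        rw [abs_mul]
        exact mul_le_mul (norm_le_pi_norm v i) (norm_le_pi_norm u i) (abs_nonneg _) (norm_nonneg _)
    _ = _ := by simp

theorem norm_mulVec_le_of_abs_le {A : Matrix ι ι ℝ} {δ : ℝ} (hδ : 0 ≤ δ)
    (hA : ∀ i j, |A i j| ≤ δ) (v : ι → ℝ) : ‖A *ᵥ v‖ ≤ Fintype.card ι * δ * ‖v‖ := by
  refine (pi_norm_le_iff_of_nonneg (by positivity)).2 fun i => ?_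
  have h1 := abs_dotProduct_le (A i) v
  have h2 : ‖A i‖ ≤ δ := (pi_norm_le_iff_of_nonneg hδ).2 fun j => hA i j
  calc ‖(A *ᵥ v) i‖ ≤ Fintype.card ι * (‖A i‖ * ‖v‖) := h1
    _ ≤ Fintype.card ι * (δ * ‖v‖) := by gcongr
    _ = _ := by ring

/-- The quadratic form of `A` is bounded below by `lam` times the square of the sup norm. -/
def IsCoercive (A : Matrix ι ι ℝ) (lam : ℝ) : Prop :=
  ∀ v : ι → ℝ, lam * ‖v‖ ^ 2 ≤ v ⬝ᵥ A *ᵥ v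

theorem IsCoercive.norm_le {A : Matrix ι ι ℝ} {lam : ℝ} (hA : IsCoercive A lam) (hl : 0 < lam)
    (v : ι → ℝ) : ‖v‖ ≤ Fintype.card ι / lam * ‖A *ᵥ v‖ := by
  rcases (norm_nonneg v).eq_or_lt with h0 | h0
  · rw [← h0]; positivity
  have h1 := (hA v).trans ((le_abs_self _).trans (abs_dotProduct_le v (A *ᵥ v)))
  have h2 : lam * ‖v‖ ≤ Fintype.card ι * ‖A *ᵥ v‖ := by
    refine le_of_mul_le_mul_right ?_ h0
    calc lam * ‖v‖ * ‖v‖ = lam * ‖v‖ ^ 2 := by ring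
      _ ≤ _ := h1
      _ = _ := by ring
  rw [div_mul_eq_mul_div, le_div_iff₀ hl]
  linarith

theorem IsCoercive.of_abs_sub_le {A B : Matrix ι ι ℝ} {lam δ : ℝ} (hA : IsCoercive A lam)
    (hδ : 0 ≤ δ) (hAB : ∀ i j, |B i j - A i j| ≤ δ) :
    IsCoercive B (lam - (Fintype.card ι : ℝ) ^ 2 * δ) := fun v => by
  have h1 : v ⬝ᵥ B *ᵥ v = v ⬝ᵥ A *ᵥ v + v ⬝ᵥ (B - A) *ᵥ v := by
    rw [sub_mulVec, dotProduct_sub]; ring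
  have h2 := (abs_le.1 ((abs_dotProduct_le v ((B - A) *ᵥ v)).trans (mul_le_mul_of_nonneg_left
    (mul_le_mul_of_nonneg_left (norm_mulVec_le_of_abs_le hδ (A := B - A) hAB v) (norm_nonneg v))
    (Nat.cast_nonneg (Fintype.card ι))))).1
  have h3 := hA v
  rw [h1]
  nlinarith

variable [DecidableEq ι]

theorem IsCoercive.isUnit_det {A : Matrix ι ι ℝ} {lam : ℝ} (hA : IsCoercive A lam)
    (hl : 0 < lam) : IsUnit A.det := by
  rw [← isUnit_iff_isUnit_det]
  refine mulVec_injective_iff_isUnit.1 fun v u hvu => ?_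
  have h := hA.norm_le hl (v - u)
  rw [mulVec_sub, sub_eq_zero.2 hvu, norm_zero, mul_zero] at h
  exact sub_eq_zero.1 (norm_le_zero_iff.1 h)

theorem IsCoercive.norm_inv_mulVec_le {A : Matrix ι ι ℝ} {lam : ℝ} (hA : IsCoercive A lam)
    (hl : 0 < lam) (S : ι → ℝ) : ‖A⁻¹ *ᵥ S‖ ≤ Fintype.card ι / lam * ‖S‖ := by
  have := hA.norm_le hl (A⁻¹ *ᵥ S)
  rwa [mulVec_mulVec, mul_nonsing_inv _ (hA.isUnit_det hl), one_mulVec] at this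

theorem sum_inv_mul_eq {A : Matrix ι ι ℝ} (hsymm : Aᵀ = A) (S : ι → ℝ) (i : ι) :
    ∑ m, A⁻¹ m i * S m = (A⁻¹ *ᵥ S) i := by
  have : (A⁻¹)ᵀ = A⁻¹ := by rw [transpose_nonsing_inv, hsymm]
  simp only [mulVec, dotProduct]
  refine Finset.sum_congr rfl fun m _ => ?_
  rw [← transpose_apply A⁻¹, this]

/-- Stability of the solution of a linear system. -/
theorem IsCoercive.norm_sub_inv_mulVec_le {A B : Matrix ι ι ℝ} {lam δ : ℝ}
    (hA : IsCoercive A lam) (hl : 0 < lam) (hδ : 0 ≤ δ) (hAB : ∀ i j, |B i j - A i j| ≤ δ)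
    (hsmall : (Fintype.card ι : ℝ) ^ 2 * δ ≤ lam / 2) {v S ρ : ι → ℝ} (hv : B *ᵥ v = S + ρ) :
    ‖v - A⁻¹ *ᵥ S‖ ≤ Fintype.card ι / (lam / 2) *
      (Fintype.card ι * δ * (Fintype.card ι / lam * ‖S‖) + ‖ρ‖) := by
  have hB : IsCoercive B (lam / 2) := fun u => by
    refine le_trans ?_ (hA.of_abs_sub_le hδ hAB u)
    exact mul_le_mul_of_nonneg_right (by linarith) (by positivity)
  refine (hB.norm_le (by linarith) _).trans ?_
  -- Only the product of the perturbation `B - A` with `A⁻¹ S` appears, so the error is of second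
  -- order when both `B - A` and `S` are small.
  have e : B *ᵥ (v - A⁻¹ *ᵥ S) = ρ - (B - A) *ᵥ (A⁻¹ *ᵥ S) := by
    rw [mulVec_sub, hv, sub_mulVec, mulVec_mulVec _ A, mul_nonsing_inv _ (hA.isUnit_det hl),
      one_mulVec]
    abel
  rw [e]
  refine mul_le_mul_of_nonneg_left ?_ (by positivity)
  refine (norm_sub_le _ _).trans ?_
  rw [add_comm]
  gcongr
  refine (norm_mulVec_le_of_abs_le hδ (A := B - A) hAB _).trans ?_
  gcongr
  exact hA.norm_inv_mulVec_le hl S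

end LinearAlgebra

/-! ### Positivity of the kernel and of the limiting quadratic form -/

section Kernel

variable {w : ℝ → ℝ}

theorem IsKernel.exists_abs_le (hw : IsKernel w) : ∃ B, ∀ t, |w t| ≤ B := by
  obtain ⟨B, hB⟩ := (isCompact_Icc (a := (-1 : ℝ)) (b := 1)).exists_bound_of_continuousOn
    hw.differentiable.continuous.continuousOn
  refine ⟨B, fun t => ?_⟩
  by_cases ht : t ∈ Set.Icc (-1 : ℝ) 1
  · exact hB t ht
  · rw [hw.support t ht, abs_zero]
    exact (norm_nonneg _).trans (hB 0 (by norm_num))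

/-- The interval lies strictly to the right of zero; its mirror image serves on the left. One of the
two remains available when `x` is near an endpoint of `[0, 1]`. -/
theorem IsKernel.exists_pos_on_Icc (hw : IsKernel w) :
    ∃ a b : ℝ, 0 < a ∧ a < b ∧ b ≤ 1 ∧ ∀ t ∈ Set.Icc a b, 0 < w t := by
  have hcont := hw.differentiable.continuous
  obtain ⟨t, ht0, ht⟩ : ∃ t : ℝ, t ≠ 0 ∧ w t ≠ 0 := by
    by_contra! hcon
    have : ∫ t, w t = 0 := by
      rw [integral_eq_zero_of_ae]
      filter_upwards [compl_mem_ae_iff.2 (measure_singleton (μ := volume) (0 : ℝ))] with t ht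
      exact hcon t ht
    rw [hw.integral_eq_one] at this
    exact one_ne_zero this
  have habs : w |t| = w t := by
    rcases abs_choice t with h | h <;> rw [h]
    exact hw.symm t
  have hpos : 0 < w |t| := habs ▸ lt_of_le_of_ne (hw.nonneg t) ht.symm
  have hle : |t| ≤ 1 := by
    by_contra hcon
    have := hw.support |t| fun h => hcon h.2
    linarith
  have ht1 : 0 < |t| := abs_pos.2 ht0
  obtain ⟨δ, hδ, hball⟩ := Metric.isOpen_iff.1 (isOpen_lt continuous_const hcont) |t| hpos
  refine ⟨max (|t| / 2) (|t| - δ / 2), |t|, lt_max_of_lt_left (by linarith),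
    max_lt (by linarith) (by linarith), hle, fun u hu => hball ?_⟩
  have := (le_max_right _ _).trans hu.1
  rw [Metric.mem_ball, Real.dist_eq, abs_lt]
  constructor <;> linarith [hu.2]

/-- The integral is continuous in `v` and positive for `v ≠ 0`, since a nonzero polynomial does not
vanish on an interval. Compactness of the unit sphere and homogeneity of degree two give the
constant. -/
theorem exists_quadratic_lower_bound {f : ℝ → ℝ} (hf : Continuous f) {a b : ℝ} (hab : a < b)
    (hpos : ∀ t ∈ Set.Icc a b, 0 < f t) (d : ℕ) :
    ∃ lam : ℝ, 0 < lam ∧ ∀ v : Fin (d + 1) → ℝ,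
      lam * ‖v‖ ^ 2 ≤ ∫ t in a..b, (∑ m, v m * t ^ (m : ℕ)) ^ 2 * f t := by
  set F : (Fin (d + 1) → ℝ) → ℝ := fun v => ∫ t in a..b, (∑ m, v m * t ^ (m : ℕ)) ^ 2 * f t with hF
  have hFc : Continuous F := by
    refine intervalIntegral.continuous_parametric_intervalIntegral_of_continuous' ?_ a b
    fun_prop
  have hFpos : ∀ v, v ≠ 0 → 0 < F v := fun v hv => by
    refine intervalIntegral.integral_pos hab (by fun_prop)
      (fun t ht => mul_nonneg (sq_nonneg _) (hpos t ⟨ht.1.le, ht.2⟩).le) ?_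
    by_contra! hcon
    apply hv
    set p : Polynomial ℝ := ∑ m : Fin (d + 1), Polynomial.C (v m) * Polynomial.X ^ (m : ℕ) with hp
    have hroot : ∀ t ∈ Set.Icc a b, p.IsRoot t := fun t ht => by
      have h1 := hcon t ht
      have h2 := hpos t ht
      have h3 : (∑ m, v m * t ^ (m : ℕ)) ^ 2 = 0 :=
        le_antisymm (nonpos_of_mul_nonpos_left h1 h2) (sq_nonneg _)
      rw [Polynomial.IsRoot.def, hp, Polynomial.eval_finsetSum]
      simpa using pow_eq_zero_iff two_ne_zero |>.1 h3
    have hp0 : p = 0 := Polynomial.eq_zero_of_infinite_isRoot p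
      ((Set.Icc_infinite hab).mono fun t ht => hroot t ht)
    funext m
    have := congrArg (fun q => Polynomial.coeff q (m : ℕ)) hp0
    simp only [hp, Polynomial.finsetSum_coeff, Polynomial.coeff_C_mul_X_pow,
      Polynomial.coeff_zero] at this
    rw [Finset.sum_eq_single m (fun k _ hk => if_neg fun h => hk (Fin.ext h.symm))
      (fun h => absurd (Finset.mem_univ m) h), if_pos rfl] at this
    exact this
  obtain ⟨u, hu, hmin⟩ := (isCompact_sphere (0 : Fin (d + 1) → ℝ) 1).exists_isMinOn
    (NormedSpace.sphere_nonempty.2 zero_le_one) hFc.continuousOn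
  have hu1 : ‖u‖ = 1 := by simpa using hu
  refine ⟨F u, hFpos u (fun h => by simp [h] at hu1), fun v => ?_⟩
  rcases eq_or_ne v 0 with rfl | hv
  · simp
  have hvn : 0 < ‖v‖ := norm_pos_iff.2 hv
  have h1 : F u ≤ F (‖v‖⁻¹ • v) := hmin (by
    rw [mem_sphere_zero_iff_norm, norm_smul, norm_inv, norm_norm, inv_mul_cancel₀ hvn.ne'])
  have h2 : F (‖v‖⁻¹ • v) = (‖v‖⁻¹) ^ 2 * F v := by
    simp only [hF]
    rw [← intervalIntegral.integral_const_mul]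
    refine intervalIntegral.integral_congr fun t _ => ?_
    simp only [Pi.smul_apply, smul_eq_mul, mul_assoc]
    rw [← Finset.mul_sum]; ring
  rw [h2] at h1
  calc F u * ‖v‖ ^ 2 ≤ (‖v‖⁻¹) ^ 2 * F v * ‖v‖ ^ 2 := by gcongr
    _ = F v := by field_simp

end Kernel

/-! ### Local polynomial approximation -/

section Taylor

variable {I : Set ℝ}

/-- Induction on `ν`: integrate the polynomial that approximates the derivative, and apply the mean
value inequality to the difference. Only the constant coefficient matters later, so the others stay
existential. -/
theorem exists_taylor_bound (hI : Convex ℝ I) (hu : UniqueDiffOn ℝ I) {x : ℝ} (hx : x ∈ I)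
    {h e : ℝ} (he : 0 ≤ e) (ν : ℕ) : ∀ f : ℝ → ℝ, ContDiffOn ℝ ν f I →
    (∀ y ∈ I, |y - x| ≤ h → |iteratedDerivWithin ν f I y - iteratedDerivWithin ν f I x| ≤ e) →
    ∃ a : ℕ → ℝ, a 0 = f x ∧ ∀ z ∈ I, |z - x| ≤ h →
      |f z - ∑ m ∈ Finset.range (ν + 1), a m * (z - x) ^ m| ≤ e * |z - x| ^ ν := by
  induction ν with
  | zero =>
    intro f _ hosc
    refine ⟨fun _ => f x, rfl, fun z hz hzx => ?_⟩
    simpa using hosc z hz hzx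
  | succ ν ih =>
    intro f hf hosc
    rw [iteratedDerivWithin_succ'] at hosc
    push_cast at hf
    obtain ⟨hfd, -, hf'⟩ := (contDiffOn_succ_iff_derivWithin hu).1 hf
    obtain ⟨a, -, ha⟩ := ih _ hf' hosc
    refine ⟨fun m => Nat.casesOn m (f x) fun k => a k / (k + 1), rfl, fun z hz hzx => ?_⟩
    set F : ℝ → ℝ := fun y => f y - (∑ m ∈ Finset.range (ν + 1), a m / (m + 1) * (y - x) ^ (m + 1)
      + f x) with hF
    -- Between `x` and `z` the derivative error is at most `e * |z - x| ^ ν`; the mean value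
    -- inequality supplies the missing factor `|z - x|`.
    set s : Set ℝ := I ∩ Set.Icc (x - |z - x|) (x + |z - x|) with hs
    have hderiv : ∀ y ∈ s, HasDerivWithinAt F
        (derivWithin f I y - ∑ m ∈ Finset.range (ν + 1), a m * (y - x) ^ m) s y := fun y hy => by
      have h1 : HasDerivWithinAt f (derivWithin f I y) s y :=
        ((hfd y hy.1).hasDerivWithinAt).mono Set.inter_subset_left
      have h2 : HasDerivAt (fun y => ∑ m ∈ Finset.range (ν + 1),
          a m / (m + 1) * (y - x) ^ (m + 1) + f x)
          (∑ m ∈ Finset.range (ν + 1), a m * (y - x) ^ m) y := by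
        refine HasDerivAt.add_const _ (HasDerivAt.fun_sum fun m _ => ?_)
        have h3 := (((hasDerivAt_id y).sub_const x).pow (m + 1)).const_mul (a m / ((m : ℝ) + 1))
        refine h3.congr_deriv ?_
        push_cast
        simp only [id]
        field_simp
      exact h1.sub h2.hasDerivWithinAt
    have hbound : ∀ y ∈ s, ‖derivWithin f I y - ∑ m ∈ Finset.range (ν + 1), a m * (y - x) ^ m‖
        ≤ e * |z - x| ^ ν := fun y hy => by
      have hyx : |y - x| ≤ |z - x| := by
        rw [abs_le]; constructor <;> linarith [hy.2.1, hy.2.2]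
      refine (ha y hy.1 (hyx.trans hzx)).trans ?_
      gcongr
    have hconv : Convex ℝ s := hI.inter (convex_Icc _ _)
    have hxs : x ∈ s := ⟨hx, by constructor <;> linarith [abs_nonneg (z - x)]⟩
    have hzs : z ∈ s := ⟨hz, by
      constructor <;> linarith [le_abs_self (z - x), neg_abs_le (z - x)]⟩
    have key := hconv.norm_image_sub_le_of_norm_hasDerivWithin_le hderiv hbound hxs hzs
    have hFx : F x = 0 := by simp [hF]
    rw [hFx, sub_zero] at key
    rw [Finset.sum_range_succ']
    simp only [pow_zero, mul_one]
    rw [pow_succ, ← mul_assoc]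
    exact key

theorem exists_local_polynomial (hI : Convex ℝ I) (hu : UniqueDiffOn ℝ I) {x : ℝ} (hx : x ∈ I)
    {c e : ℝ} (hc : 0 < c) (he : 0 ≤ e) {ν d : ℕ} (hνd : ν ≤ d) {r : ℝ → ℝ}
    (hr : ContDiffOn ℝ ν r I)
    (hosc : ∀ y ∈ I, |y - x| ≤ c →
      |iteratedDerivWithin ν r I y - iteratedDerivWithin ν r I x| ≤ e) :
    ∃ b : Fin (d + 1) → ℝ, b 0 = r x ∧ ∀ z ∈ I, |z - x| ≤ c →
      |r z - ∑ m, b m * ((z - x) / c) ^ (m : ℕ)| ≤ e * c ^ ν := by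
  obtain ⟨a, ha0, ha⟩ := exists_taylor_bound hI hu hx he ν r hr hosc
  refine ⟨fun m => if (m : ℕ) < ν + 1 then a m * c ^ (m : ℕ) else 0, by simp [ha0],
    fun z hz hzx => ?_⟩
  have hsum : ∑ m : Fin (d + 1), (if (m : ℕ) < ν + 1 then a m * c ^ (m : ℕ) else 0)
      * ((z - x) / c) ^ (m : ℕ) = ∑ m ∈ Finset.range (ν + 1), a m * (z - x) ^ m := by
    rw [Fin.sum_univ_eq_sum_range (fun m => (if m < ν + 1 then a m * c ^ m else 0)
      * ((z - x) / c) ^ m) (d + 1)]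
    rw [← Finset.sum_subset (Finset.range_mono (by omega : ν + 1 ≤ d + 1))
      (fun m _ hm => by rw [if_neg (by simpa using hm), zero_mul])]
    refine Finset.sum_congr rfl fun m hm => ?_
    rw [if_pos (Finset.mem_range.1 hm), div_pow]
    field_simp
  rw [hsum]
  refine (ha z hz hzx).trans ?_
  gcongr

/-- `I` may be open or unbounded, so uniform continuity needs a compact part of `I` that contains
every nearby window. At a side where `I` ends at 0 or 1, that endpoint is used. -/
theorem exists_compact_Icc_subset (hI : I.OrdConnected) (h01 : Set.Icc 0 1 ⊆ I) :
    ∃ a b δ : ℝ, 0 < δ ∧ a ≤ 0 ∧ 1 ≤ b ∧ Set.Icc a b ⊆ I ∧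
      ∀ y ∈ I, -δ ≤ y → y ≤ 1 + δ → y ∈ Set.Icc a b := by
  have h0 : (0 : ℝ) ∈ I := h01 (by norm_num)
  have h1 : (1 : ℝ) ∈ I := h01 (by norm_num)
  obtain ⟨a, δ₁, hδ₁, ha0, haI, ha⟩ : ∃ a δ₁ : ℝ, 0 < δ₁ ∧ a ≤ 0 ∧ a ∈ I ∧
      ∀ y ∈ I, -δ₁ ≤ y → a ≤ y := by
    by_cases h : ∃ a ∈ I, a < 0
    · obtain ⟨a, haI, ha⟩ := h
      exact ⟨a, -a, by linarith, ha.le, haI, fun y _ hy => by linarith⟩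
    · push Not at h
      exact ⟨0, 1, one_pos, le_rfl, h0, fun y hy _ => h y hy⟩
  obtain ⟨b, δ₂, hδ₂, hb1, hbI, hb⟩ : ∃ b δ₂ : ℝ, 0 < δ₂ ∧ 1 ≤ b ∧ b ∈ I ∧
      ∀ y ∈ I, y ≤ 1 + δ₂ → y ≤ b := by
    by_cases h : ∃ b ∈ I, 1 < b
    · obtain ⟨b, hbI, hb⟩ := h
      exact ⟨b, b - 1, by linarith, hb.le, hbI, fun y _ hy => by linarith⟩
    · push Not at h
      exact ⟨1, 1, one_pos, le_rfl, h1, fun y hy _ => h y hy⟩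
  refine ⟨a, b, min δ₁ δ₂, lt_min hδ₁ hδ₂, ha0, hb1, hI.out haI hbI, fun y hy h2 h3 => ⟨?_, ?_⟩⟩
  · exact ha y hy (by linarith [min_le_left δ₁ δ₂])
  · exact hb y hy (by linarith [min_le_right δ₁ δ₂])

theorem exists_modulus (hI : I.OrdConnected) (h01 : Set.Icc 0 1 ⊆ I) {f : ℝ → ℝ}
    (hf : ContinuousOn f I) {c : ℕ → ℝ} (hc : Tendsto c atTop (𝓝 0)) :
    ∃ e : ℕ → ℝ, (∀ n, 0 ≤ e n) ∧ Tendsto e atTop (𝓝 0) ∧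
      ∀ᶠ n in atTop, ∀ x ∈ Set.Icc (0 : ℝ) 1, ∀ y ∈ I, |y - x| ≤ c n → |f y - f x| ≤ e n := by
  obtain ⟨a, b, δ, hδ, ha, hb, hab, hmem⟩ := exists_compact_Icc_subset hI h01
  -- The infimum of the admissible bounds is the modulus. For small `n` there may be none, and `sInf
  -- ∅ = 0`; hence the inequality is asserted only eventually.
  set S : ℕ → Set ℝ := fun n => {t | 0 ≤ t ∧
    ∀ x ∈ Set.Icc (0 : ℝ) 1, ∀ y ∈ I, |y - x| ≤ c n → |f y - f x| ≤ t} with hS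
  have hSbdd : ∀ n, BddBelow (S n) := fun n => ⟨0, fun t ht => ht.1⟩
  have hev : ∀ t : ℝ, 0 < t → ∀ᶠ n in atTop, t ∈ S n := fun t ht => by
    have huc := isCompact_Icc.uniformContinuousOn_of_continuous (hf.mono hab)
    obtain ⟨h₀, hh₀, huc⟩ := Metric.uniformContinuousOn_iff.1 huc t ht
    filter_upwards [hc.eventually_lt_const hh₀, hc.eventually_lt_const hδ] with n h1 h2
    refine ⟨ht.le, fun x hx y hy hyx => ?_⟩
    have hyx' := abs_le.1 hyx
    exact (huc y (hmem y hy (by linarith [hx.1]) (by linarith [hx.2])) x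
      ⟨ha.trans hx.1, hx.2.trans hb⟩ (lt_of_le_of_lt hyx h1)).le
  refine ⟨fun n => sInf (S n), fun n => Real.sInf_nonneg fun t ht => ht.1, ?_, ?_⟩
  · rw [Metric.tendsto_atTop']
    intro t ht
    obtain ⟨N, hN⟩ := eventually_atTop.1 (hev (t / 2) (by linarith))
    refine ⟨N, fun n hn => ?_⟩
    rw [Real.dist_eq, sub_zero, abs_of_nonneg (Real.sInf_nonneg fun t ht => ht.1)]
    exact lt_of_le_of_lt (csInf_le (hSbdd n) (hN n hn.le)) (by linarith)
  · filter_upwards [hev 1 one_pos] with n hn x hx y hy hyx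
    exact le_csInf ⟨1, hn⟩ fun t ht => ht.2 x hx y hy hyx

end Taylor

/-! ### Normal equations -/

section LeastSquares

variable {w : ℝ → ℝ} {d : ℕ} {c : ℝ} {n : ℕ} {Z Y : ℕ → ℝ} {x : ℝ}

/-- Along the `k`-th coordinate direction the criterion is a quadratic polynomial in the step `s`,
minimal at `s = 0`, so its linear coefficient vanishes. -/
theorem normal_equation {b : Fin (d + 1) → ℝ}
    (hb : ∀ b', loss w d c n Z Y x b ≤ loss w d c n Z Y x b') (k : Fin (d + 1)) :
    ∑ j ∈ Finset.range n, (Y j - ∑ m : Fin (d + 1), b m * ((Z j - x) / c) ^ (m : ℕ))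
      * ((Z j - x) / c) ^ (k : ℕ) * (1 / c * w ((Z j - x) / c)) = 0 := by
  set u : ℕ → ℝ := fun j => (Z j - x) / c with hu
  set ω : ℕ → ℝ := fun j => 1 / c * w (u j) with hω
  set R : ℕ → ℝ := fun j => Y j - ∑ m : Fin (d + 1), b m * u j ^ (m : ℕ) with hR
  set A : ℝ := ∑ j ∈ Finset.range n, R j * u j ^ (k : ℕ) * ω j with hA
  set B : ℝ := ∑ j ∈ Finset.range n, (u j ^ (k : ℕ)) ^ 2 * ω j with hB
  have hexp : ∀ s : ℝ, loss w d c n Z Y x (b + s • Pi.single k 1)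
      = loss w d c n Z Y x b - 2 * s * A + s ^ 2 * B := fun s => by
    simp only [loss, hA, hB, Finset.mul_sum, ← Finset.sum_sub_distrib, ← Finset.sum_add_distrib]
    refine Finset.sum_congr rfl fun j _ => ?_
    have e1 : ∑ m : Fin (d + 1), (b + s • (Pi.single k 1 : Fin (d + 1) → ℝ)) m * u j ^ (m : ℕ)
        = ∑ m : Fin (d + 1), b m * u j ^ (m : ℕ) + s * u j ^ (k : ℕ) := by
      simp only [Pi.add_apply, Pi.smul_apply, smul_eq_mul, add_mul, Finset.sum_add_distrib]
      congr 1
      rw [Finset.sum_eq_single k (fun m _ hm => by simp [Pi.single_eq_of_ne hm])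
        (fun h => absurd (Finset.mem_univ k) h)]
      simp
    change (Y j - ∑ m : Fin (d + 1), (b + s • (Pi.single k 1 : Fin (d + 1) → ℝ)) m
      * u j ^ (m : ℕ)) ^ 2 * ω j = (R j) ^ 2 * ω j - 2 * s * (R j * u j ^ (k : ℕ) * ω j)
        + s ^ 2 * ((u j ^ (k : ℕ)) ^ 2 * ω j)
    rw [e1, hR]
    ring
  have hquad : ∀ s : ℝ, 0 ≤ -(2 * s * A) + s ^ 2 * B := fun s => by
    have := hb (b + s • Pi.single k 1)
    rw [hexp s] at this
    linarith
  change A = 0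
  by_contra hne
  have hD : 0 < |B| + 1 := by positivity
  -- A step short enough for the linear term to dominate, whatever the sign or size of `B`.
  have h1 := hquad (A / (|B| + 1))
  have h2 : -(2 * (A / (|B| + 1)) * A) + (A / (|B| + 1)) ^ 2 * B
      = A ^ 2 / (|B| + 1) ^ 2 * (B - 2 * (|B| + 1)) := by field_simp; ring
  rw [h2] at h1
  have h3 : 0 < A ^ 2 / (|B| + 1) ^ 2 := by positivity
  have h4 : B - 2 * (|B| + 1) < 0 := by linarith [le_abs_self B, abs_nonneg B]
  linarith [mul_neg_of_pos_of_neg h3 h4]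

end LeastSquares

/-! ### Moment kernels and uniform coercivity of the expected matrix -/

/-- The kernel `t ↦ t ^ m * w t`. -/
noncomputable def monoKernel (w : ℝ → ℝ) (m : ℕ) (t : ℝ) : ℝ := t ^ m * w t

section Kernel

variable {w : ℝ → ℝ}

theorem IsKernel.exists_isLipschitzBump (hw : IsKernel w) (m : ℕ) :
    ∃ L B, IsLipschitzBump (monoKernel w m) L B := by
  obtain ⟨B, hB⟩ := hw.exists_abs_le
  obtain ⟨C, hC⟩ := hw.deriv_bounded
  have hB0 : 0 ≤ B := (abs_nonneg _).trans (hB 0)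
  have hderiv : ∀ t, HasDerivAt (monoKernel w m)
      (m * t ^ (m - 1) * w t + t ^ m * deriv w t) t := fun t =>
    (hasDerivAt_pow m t).mul (hw.differentiable t).hasDerivAt
  have hbound : ∀ t, ‖(m : ℝ) * t ^ (m - 1) * w t + t ^ m * deriv w t‖ ≤ m * B + C := fun t => by
    by_cases ht : t ∈ Set.Icc (-1 : ℝ) 1
    · have ht' : |t| ≤ 1 := abs_le.2 ht
      have hp : ∀ k : ℕ, |t| ^ k ≤ 1 := fun k => pow_le_one₀ (abs_nonneg _) ht'
      rw [Real.norm_eq_abs]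
      refine (abs_add_le _ _).trans ?_
      rw [abs_mul, abs_mul, abs_mul, abs_pow, abs_pow, Nat.abs_cast]
      calc (m : ℝ) * |t| ^ (m - 1) * |w t| + |t| ^ m * |deriv w t|
          ≤ m * 1 * B + 1 * C := by
            gcongr
            · exact hp _
            · exact hB t
            · exact hp _
            · exact hC t
        _ = _ := by ring
    -- The complement of `[-1, 1]` is open, so the derivative vanishes there as well and the bound
    -- is global.
    · have h0 : w =ᶠ[𝓝 t] fun _ => 0 := by
        filter_upwards [isClosed_Icc.isOpen_compl.mem_nhds ht] with s hs
        exact hw.support s hs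
      rw [h0.deriv_eq, hw.support t ht]
      have := (abs_nonneg _).trans (hC 0)
      simp only [mul_zero, deriv_const', add_zero, norm_zero]
      positivity
  refine ⟨m * B + C, B, fun s t => ?_, fun t => ?_, fun t ht => ?_⟩
  · exact convex_univ.norm_image_sub_le_of_norm_hasDerivWithin_le
      (fun u _ => (hderiv u).hasDerivWithinAt) (fun u _ => hbound u) (Set.mem_univ t)
      (Set.mem_univ s)
  · by_cases ht : t ∈ Set.Icc (-1 : ℝ) 1
    · rw [monoKernel, abs_mul, abs_pow]
      calc |t| ^ m * |w t| ≤ 1 * B := by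
            gcongr
            · exact pow_le_one₀ (abs_nonneg _) (abs_le.2 ht)
            · exact hB t
        _ = B := one_mul B
    · rw [monoKernel, hw.support t ht, mul_zero, abs_zero]
      exact hB0
  · rw [monoKernel, hw.support t ht, mul_zero]

theorem wScaled_eq {c : ℝ} (hc : 0 < c) (m : ℕ) (u : ℝ) :
    wScaled w c m u = 1 / c * monoKernel w m (u / c) := by
  rw [wScaled, monoKernel, div_pow, pow_succ]
  field_simp

theorem q_eq_kernelMean {c : ℝ} (hc : 0 < c) (n m : ℕ) (Z : ℕ → ℝ) (x : ℝ) :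
    q w c n m Z x = kernelMean (monoKernel w m) c n Z (fun _ => 1) x := by
  simp only [q, kernelMean, wScaled_eq hc, mul_one]

end Kernel

section Coercive

theorem QBar_transpose {Ω : Type*} [MeasurableSpace Ω] (P : Measure Ω) (w : ℝ → ℝ)
    (Z : ℕ → Ω → ℝ) (d : ℕ) (c : ℝ) (n : ℕ) (x : ℝ) :
    (QBar P w d c n Z x).transpose = QBar P w d c n Z x := by
  ext k m
  simp only [Matrix.transpose_apply, QBar, Matrix.of_apply, add_comm]

variable {Ω : Type*} [MeasurableSpace Ω] {P : Measure Ω} [IsProbabilityMeasure P]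
  {Z : ℕ → Ω → ℝ} {g w : ℝ → ℝ}

/-- As `f ≥ 0`, the law of `X` may be replaced by the smaller measure `l` times Lebesgue measure on
a part of the window inside `[0, 1]`; rescaling produces the factor `c`. -/
theorem density_lower_bound {X : Ω → ℝ} (hX : Measurable X)
    (hXg : P.map X = volume.withDensity fun z => ENNReal.ofReal (g z)) {l : ℝ} (hl0 : 0 ≤ l)
    (hl : ∀ z ∈ Set.Icc (0 : ℝ) 1, l ≤ g z) {f : ℝ → ℝ} (hf : Continuous f) (hf0 : ∀ t, 0 ≤ f t)
    {B : ℝ} (hB : ∀ t, f t ≤ B) {c x a b : ℝ} (hc : 0 < c) (hab : a ≤ b) (ha : 0 ≤ x + c * a)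
    (hb : x + c * b ≤ 1) :
    l * (c * ∫ t in a..b, f t) ≤ ∫ ω, f ((X ω - x) / c) ∂P := by
  set S : Set ℝ := Set.Ioc (x + c * a) (x + c * b) with hS
  have hSm : MeasurableSet S := measurableSet_Ioc
  have hle : ENNReal.ofReal l • volume.restrict S ≤ P.map X := by
    rw [hXg, ← withDensity_const, ← withDensity_indicator hSm]
    refine withDensity_mono (.of_forall fun z => ?_)
    by_cases hz : z ∈ S
    · rw [Set.indicator_of_mem hz]
      exact ENNReal.ofReal_le_ofReal (hl z ⟨ha.trans hz.1.le, hz.2.trans hb⟩)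
    · rw [Set.indicator_of_notMem hz]; exact zero_le
  have hfc : Continuous fun z => f ((z - x) / c) := by fun_prop
  have : IsProbabilityMeasure (P.map X) := Measure.isProbabilityMeasure_map hX.aemeasurable
  have hint : Integrable (fun z => f ((z - x) / c)) (P.map X) :=
    Integrable.of_bound hfc.aestronglyMeasurable B (.of_forall fun z => by
      rw [Real.norm_of_nonneg (hf0 _)]; exact hB _)
  have h1 := integral_mono_measure hle (.of_forall fun z => hf0 _) hint
  rw [integral_map hX.aemeasurable hfc.aestronglyMeasurable, integral_smul_measure,
    ENNReal.toReal_ofReal hl0, smul_eq_mul] at h1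
  refine le_trans (le_of_eq ?_) h1
  congr 1
  rw [← intervalIntegral.integral_of_le (by gcongr)]
  simp_rw [sub_div]
  rw [intervalIntegral.integral_comp_div_sub f hc.ne', smul_eq_mul]
  congr 2 <;> field_simp <;> ring

theorem dotProduct_QBar_mulVec (hZm : ∀ j, Measurable (Z j)) (hw : IsKernel w) {d : ℕ} {c : ℝ}
    (hc : 0 < c) (n : ℕ) (x : ℝ) (v : Fin (d + 1) → ℝ) :
    v ⬝ᵥ (QBar P w d c n Z x).mulVec v = 1 / (n : ℝ) * ∑ j ∈ Finset.range n,
      (1 / c * ∫ ω, (∑ m, v m * ((Z j ω - x) / c) ^ (m : ℕ)) ^ 2 * w ((Z j ω - x) / c) ∂P) := by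
  have hterm : ∀ (j m : ℕ), Integrable (fun ω => 1 / c * monoKernel w m ((Z j ω - x) / c) * 1) P :=
    fun j m => by
      obtain ⟨L, B, hφ⟩ := hw.exists_isLipschitzBump m
      exact integrable_kernelMean_term (y := fun _ => 1) hφ hc (hZm j) measurable_const
        (integrable_const _) x
  have hq : ∀ m, qBar P w c n m Z x
      = 1 / (n : ℝ) * ∑ j ∈ Finset.range n, ∫ ω, 1 / c * monoKernel w m ((Z j ω - x) / c) ∂P :=
    fun m => by
      obtain ⟨L, B, hφ⟩ := hw.exists_isLipschitzBump m
      simp only [qBar, q_eq_kernelMean hc]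
      rw [integral_kernelMean (η := fun _ _ => 1) hφ hc hZm (fun _ => measurable_const)
        (fun _ => integrable_const _)]
      simp only [mul_one]
  simp only [mul_one] at hterm
  have hj : ∀ j, 1 / c * ∫ ω, (∑ m, v m * ((Z j ω - x) / c) ^ (m : ℕ)) ^ 2 * w ((Z j ω - x) / c) ∂P
      = ∑ k : Fin (d + 1), ∑ m : Fin (d + 1), v k * (v m *
        ∫ ω, 1 / c * monoKernel w ((k : ℕ) + (m : ℕ)) ((Z j ω - x) / c) ∂P) := fun j => by
    simp_rw [← integral_const_mul]
    have hi : ∀ k m : Fin (d + 1), Integrable (fun ω => v k * (v m *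
        (1 / c * monoKernel w ((k : ℕ) + (m : ℕ)) ((Z j ω - x) / c)))) P := fun k m =>
      ((hterm j _).const_mul _).const_mul _
    rw [Finset.sum_congr rfl fun k _ => (integral_finsetSum Finset.univ fun m _ => hi k m).symm]
    rw [← integral_finsetSum _ fun k _ => integrable_finsetSum _ fun m _ => hi k m]
    refine integral_congr_ae (.of_forall fun ω => ?_)
    simp only [monoKernel]
    rw [sq, Finset.sum_mul_sum, Finset.sum_mul, Finset.mul_sum]
    refine Finset.sum_congr rfl fun k _ => ?_
    rw [Finset.sum_mul, Finset.mul_sum]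
    refine Finset.sum_congr rfl fun m _ => ?_
    rw [pow_add]; ring
  simp_rw [hj]
  simp only [dotProduct, Matrix.mulVec, QBar, Matrix.of_apply, hq]
  rw [Finset.sum_comm, Finset.mul_sum]
  refine Finset.sum_congr rfl fun k _ => ?_
  rw [Finset.sum_comm, Finset.mul_sum, Finset.mul_sum]
  refine Finset.sum_congr rfl fun m _ => ?_
  rw [Finset.mul_sum, Finset.mul_sum, Finset.sum_mul, Finset.mul_sum]
  refine Finset.sum_congr rfl fun j _ => ?_
  ring

/-- The matrices `QBar` are uniformly coercive. -/
theorem exists_isCoercive_QBar (hZm : ∀ j, Measurable (Z j)) (hg : IsCovariateDensity g)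
    (hZg : ∀ j, P.map (Z j) = volume.withDensity fun z => ENNReal.ofReal (g z))
    (hw : IsKernel w) (d : ℕ) :
    ∃ lam : ℝ, 0 < lam ∧ ∀ n : ℕ, 0 < n → ∀ c : ℝ, 0 < c → c ≤ 1 / 2 →
      ∀ x ∈ Set.Icc (0 : ℝ) 1, IsCoercive (QBar P w d c n Z x) lam := by
  obtain ⟨a, b, ha, hab, hb, hpos⟩ := hw.exists_pos_on_Icc
  obtain ⟨l, hl, hlg⟩ := hg.bounded_below
  have hwc := hw.differentiable.continuous
  obtain ⟨lam₁, hlam₁, h₁⟩ := exists_quadratic_lower_bound hwc hab hpos d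
  obtain ⟨lam₂, hlam₂, h₂⟩ := exists_quadratic_lower_bound hwc (neg_lt_neg hab)
    (fun t ht => by
      rw [← hw.symm]
      exact hpos _ ⟨by linarith [ht.2], by linarith [ht.1]⟩) d
  have hm : 0 < min lam₁ lam₂ := lt_min hlam₁ hlam₂
  refine ⟨l * min lam₁ lam₂, by positivity, fun n hn c hc hc2 x hx v => ?_⟩
  have hn' : (0 : ℝ) < n := by exact_mod_cast hn
  rw [dotProduct_QBar_mulVec hZm hw hc]
  set f : ℝ → ℝ := fun t => (∑ m, v m * t ^ (m : ℕ)) ^ 2 * w t with hf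
  have hfc : Continuous f := by fun_prop
  have hf0 : ∀ t, 0 ≤ f t := fun t => mul_nonneg (sq_nonneg _) (hw.nonneg t)
  obtain ⟨B, hB⟩ : ∃ B, ∀ t, f t ≤ B := by
    obtain ⟨B, hB⟩ := (isCompact_Icc (a := (-1 : ℝ)) (b := 1)).exists_bound_of_continuousOn
      hfc.continuousOn
    refine ⟨B, fun t => ?_⟩
    by_cases ht : t ∈ Set.Icc (-1 : ℝ) 1
    · exact (le_abs_self _).trans (hB t ht)
    · simp only [hf, hw.support t ht, mul_zero]
      exact (norm_nonneg _).trans (hB 0 (by norm_num))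
  have hterm : ∀ j, l * min lam₁ lam₂ * ‖v‖ ^ 2 ≤ 1 / c * ∫ ω, f ((Z j ω - x) / c) ∂P :=
    fun j => by
      have hkey : l * (c * (min lam₁ lam₂ * ‖v‖ ^ 2)) ≤ ∫ ω, f ((Z j ω - x) / c) ∂P := by
        -- As `c ≤ 1 / 2` and `b ≤ 1`, the right part of the window stays below 1 in the first case,
        -- and the left part stays above 0 in the second.
        rcases le_total x (1 / 2) with hx2 | hx2
        · refine le_trans ?_ (density_lower_bound (hZm j) (hZg j) hl.le hlg hfc hf0 hB hc hab.le
            (by have := hx.1; positivity) (by nlinarith))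
          gcongr
          refine le_trans ?_ (h₁ v)
          gcongr
          exact min_le_left _ _
        · refine le_trans ?_ (density_lower_bound (hZm j) (hZg j) hl.le hlg hfc hf0 hB hc
            (neg_lt_neg hab).le (by nlinarith) (by nlinarith [hx.2]))
          gcongr
          refine le_trans ?_ (h₂ v)
          gcongr
          exact min_le_right _ _
      calc l * min lam₁ lam₂ * ‖v‖ ^ 2 = 1 / c * (l * (c * (min lam₁ lam₂ * ‖v‖ ^ 2))) := by
            field_simp
        _ ≤ _ := by gcongr
  calc l * min lam₁ lam₂ * ‖v‖ ^ 2
      = 1 / (n : ℝ) * ∑ j ∈ Finset.range n, l * min lam₁ lam₂ * ‖v‖ ^ 2 := by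
        rw [Finset.sum_const, Finset.card_range, nsmul_eq_mul]; field_simp
    _ ≤ _ := mul_le_mul_of_nonneg_left (Finset.sum_le_sum fun j _ => hterm j) (by positivity)

end Coercive

/-! ### The linear system solved by the smoother -/

section Smoother

variable {w : ℝ → ℝ} {d : ℕ} {c : ℝ} {n : ℕ} {Z ε : ℕ → ℝ} {x : ℝ}

/-- The empirical counterpart of `QBar`. -/
noncomputable def QHat (w : ℝ → ℝ) (d : ℕ) (c : ℝ) (n : ℕ) (Z : ℕ → ℝ) (x : ℝ) :
    Matrix (Fin (d + 1)) (Fin (d + 1)) ℝ :=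
  Matrix.of fun k m => q w c n ((k : ℕ) + (m : ℕ)) Z x

/-- In the normal equations the residual splits into `ε j`, the approximation error of `b₀` and
minus the polynomial with coefficients `b - b₀`. The kernel discards all points with `|Z j - x| >
c`, so the local bound on `b₀` suffices. -/
theorem exists_QHat_mulVec_eq (hw : IsKernel w) (hc : 0 < c) {r : ℝ → ℝ} {I : Set ℝ}
    (hZ : ∀ j, Z j ∈ I) {b b₀ : Fin (d + 1) → ℝ}
    (hb : ∀ b', loss w d c n Z (fun j => r (Z j) + ε j) x b
      ≤ loss w d c n Z (fun j => r (Z j) + ε j) x b') {v : ℝ}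
    (hb₀ : ∀ z ∈ I, |z - x| ≤ c → |r z - ∑ m, b₀ m * ((z - x) / c) ^ (m : ℕ)| ≤ v) (hv : 0 ≤ v) :
    ∃ ρ : Fin (d + 1) → ℝ, ‖ρ‖ ≤ v * q w c n 0 Z x ∧
      (QHat w d c n Z x).mulVec (b - b₀)
        = (fun k : Fin (d + 1) => kernelMean (monoKernel w k) c n Z ε x) + ρ := by
  have hnn : 0 ≤ q w c n 0 Z x := by
    rw [q_eq_kernelMean hc]
    refine mul_nonneg (by positivity) (Finset.sum_nonneg fun j _ => ?_)
    have := hw.nonneg ((Z j - x) / c)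
    simp only [monoKernel]; positivity
  refine ⟨fun k => kernelMean (monoKernel w k) c n Z
    (fun j => r (Z j) - ∑ m, b₀ m * ((Z j - x) / c) ^ (m : ℕ)) x, ?_, ?_⟩
  · refine (pi_norm_le_iff_of_nonneg (by positivity)).2 fun k => ?_
    rw [q_eq_kernelMean hc, Real.norm_eq_abs]
    simp only [kernelMean]
    rw [abs_mul, abs_of_nonneg (by positivity : 0 ≤ 1 / (n : ℝ)), mul_left_comm, Finset.mul_sum]
    refine mul_le_mul_of_nonneg_left ?_ (by positivity)
    refine (Finset.abs_sum_le_sum_abs _ _).trans (Finset.sum_le_sum fun j _ => ?_)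
    by_cases ht : (Z j - x) / c ∈ Set.Icc (-1 : ℝ) 1
    · have ht' : |(Z j - x) / c| ≤ 1 := abs_le.2 ht
      have hzx : |Z j - x| ≤ c := by
        rwa [abs_div, abs_of_pos hc, div_le_one hc] at ht'
      have h1 := hb₀ (Z j) (hZ j) hzx
      have h2 := hw.nonneg ((Z j - x) / c)
      simp only [monoKernel]
      rw [abs_mul, abs_mul, abs_mul, abs_pow, abs_of_nonneg h2,
        abs_of_pos (by positivity : 0 < 1 / c)]
      calc _ ≤ 1 / c * (1 * w ((Z j - x) / c)) * v := by
            gcongr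
            exact pow_le_one₀ (abs_nonneg _) ht'
        _ = _ := by ring
    · simp [monoKernel, hw.support _ ht]
  · funext k
    have hn := normal_equation hb k
    simp only [Matrix.mulVec, dotProduct, QHat, Matrix.of_apply, q_eq_kernelMean hc, kernelMean,
      Pi.add_apply, Pi.sub_apply]
    rw [← mul_add, ← Finset.sum_add_distrib]
    simp_rw [mul_assoc (1 / (n : ℝ))]
    rw [← Finset.mul_sum]
    congr 1
    simp_rw [Finset.sum_mul]
    rw [Finset.sum_comm, ← sub_eq_zero, ← Finset.sum_sub_distrib, ← neg_eq_zero,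
      ← Finset.sum_neg_distrib, ← hn]
    refine Finset.sum_congr rfl fun j _ => ?_
    have e1 : ∑ m : Fin (d + 1), 1 / c * monoKernel w ((k : ℕ) + (m : ℕ)) ((Z j - x) / c) * 1
        * (b m - b₀ m) = 1 / c * monoKernel w k ((Z j - x) / c)
          * (∑ m, b m * ((Z j - x) / c) ^ (m : ℕ) - ∑ m, b₀ m * ((Z j - x) / c) ^ (m : ℕ)) := by
      rw [← Finset.sum_sub_distrib, Finset.mul_sum]
      refine Finset.sum_congr rfl fun m _ => ?_
      simp only [monoKernel, pow_add]; ring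
    rw [e1]
    simp only [monoKernel]; ring

end Smoother

/-! ### Stochastic order symbols -/

section StochasticOrder

variable {Ω : Type*} [MeasurableSpace Ω] {P : Measure Ω}

theorem IsBigOP.sup {X Y : ℕ → Ω → ℝ≥0∞} {a : ℕ → ℝ} (hX : IsBigOP P X a) (hY : IsBigOP P Y a)
    (ha : ∀ᶠ n in atTop, 0 ≤ a n) : IsBigOP P (fun n ω => X n ω ⊔ Y n ω) a := by
  intro e he
  have he2 : 0 < e / 2 := ENNReal.half_pos he.ne'
  obtain ⟨M, hM, h1⟩ := hX _ he2
  obtain ⟨M', hM', h2⟩ := hY _ he2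
  refine ⟨max M M', lt_max_of_lt_left hM, ?_⟩
  filter_upwards [h1, h2, ha] with n h1 h2 han
  calc _ ≤ P ({ω | ENNReal.ofReal (M * a n) < X n ω} ∪ {ω | ENNReal.ofReal (M' * a n) < Y n ω}) :=
        measure_mono fun ω hω => by
          rcases lt_sup_iff.1 (show _ < X n ω ⊔ Y n ω from hω) with h | h
          · exact Or.inl (lt_of_le_of_lt (ENNReal.ofReal_le_ofReal
              (mul_le_mul_of_nonneg_right (le_max_left _ _) han)) h)
          · exact Or.inr (lt_of_le_of_lt (ENNReal.ofReal_le_ofReal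
              (mul_le_mul_of_nonneg_right (le_max_right _ _) han)) h)
    _ ≤ _ := measure_union_le _ _
    _ ≤ e / 2 + e / 2 := add_le_add h1 h2
    _ = e := ENNReal.add_halves e

theorem IsBigOP.finset_sup {X : ℕ → ℕ → Ω → ℝ≥0∞} {a : ℕ → ℝ} (hX : ∀ k, IsBigOP P (X k) a)
    (ha : ∀ᶠ n in atTop, 0 ≤ a n) (N : ℕ) :
    IsBigOP P (fun n ω => (Finset.range N).sup fun k => X k n ω) a := by
  induction N with
  | zero => exact fun e he => ⟨1, one_pos, .of_forall fun n => by simp⟩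
  | succ N ih =>
    simp only [Finset.range_add_one, Finset.sup_insert]
    exact (hX N).sup ih ha

/-- A sequence that is `O_p(a n)` up to a deterministic term is the sum of a sequence that is
`O_p(a n)` and a sequence that is bounded by the deterministic term. -/
theorem exists_add_decomposition {T : ℕ → Ω → ℝ≥0∞} {a v : ℕ → ℝ} (hv : ∀ n, 0 ≤ v n)
    (ha : ∀ᶠ n in atTop, 0 ≤ a n)
    (hT : ∀ e : ℝ≥0∞, 0 < e → ∃ M : ℝ, 0 < M ∧ ∀ᶠ n in atTop,
      P {ω | ENNReal.ofReal (M * a n + v n) < T n ω} ≤ e) :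
    ∃ U V : ℕ → Ω → ℝ≥0∞, (∀ n ω, T n ω = U n ω + V n ω) ∧ IsBigOP P U a ∧
      ∀ n ω, V n ω ≤ ENNReal.ofReal (v n) := by
  -- `U` is the excess of `T` over `v`; if `U` exceeds `M * a`, then `T` exceeds `M * a + v`.
  refine ⟨fun n ω => T n ω - min (T n ω) (ENNReal.ofReal (v n)),
    fun n ω => min (T n ω) (ENNReal.ofReal (v n)),
    fun n ω => (tsub_add_cancel_of_le (min_le_left _ _)).symm, ?_, fun n ω => min_le_right _ _⟩
  intro e he
  obtain ⟨M, hM, h⟩ := hT e he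
  refine ⟨M, hM, ?_⟩
  filter_upwards [h, ha] with n hn han
  refine (measure_mono fun ω hω => ?_).trans hn
  simp only [Set.mem_ofPred_eq] at hω ⊢
  rcases le_total (T n ω) (ENNReal.ofReal (v n)) with hle | hle
  · rw [min_eq_left hle, tsub_self] at hω
    exact absurd hω not_lt_zero
  · rw [min_eq_right hle, lt_tsub_iff_right] at hω
    rwa [ENNReal.ofReal_add (by positivity) (hv n)]

theorem IsLittleOP.of_le {V : ℕ → Ω → ℝ≥0∞} {a v : ℕ → ℝ}
    (hV : ∀ n ω, V n ω ≤ ENNReal.ofReal (v n))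
    (h : ∀ δ : ℝ, 0 < δ → ∀ᶠ n in atTop, v n ≤ δ * a n) : IsLittleOP P V a := by
  intro δ hδ
  refine tendsto_const_nhds.congr' ?_
  filter_upwards [h δ hδ] with n hn
  have : {ω | ENNReal.ofReal (δ * a n) < V n ω} = ∅ :=
    Set.eq_empty_of_forall_notMem fun ω hω =>
      absurd hω (not_lt.2 ((hV n ω).trans (ENNReal.ofReal_le_ofReal hn)))
  rw [this, measure_empty]

theorem IsBigOP.of_le {V : ℕ → Ω → ℝ≥0∞} {a v : ℕ → ℝ}
    (hV : ∀ n ω, V n ω ≤ ENNReal.ofReal (v n)) {M : ℝ} (hM : 0 < M)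
    (h : ∀ n, v n ≤ M * a n) : IsBigOP P V a := by
  refine fun e _ => ⟨M, hM, .of_forall fun n => ?_⟩
  have : {ω | ENNReal.ofReal (M * a n) < V n ω} = ∅ :=
    Set.eq_empty_of_forall_notMem fun ω hω =>
      absurd hω (not_lt.2 ((hV n ω).trans (ENNReal.ofReal_le_ofReal (h n))))
  rw [this, measure_empty]
  exact zero_le

end StochasticOrder

/-! ### Rates for the moments, the noise and the smoother -/

section Noise

/-- The uniform norm of the first `N` kernel weighted means of the noise. -/
noncomputable def noiseSup {Ω : Type*} (w : ℝ → ℝ) (c : ℝ) (n : ℕ) (Z ε : ℕ → Ω → ℝ) (N : ℕ)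
    (ω : Ω) : ℝ≥0∞ :=
  (Finset.range N).sup fun k => supUnit fun x =>
    kernelMean (monoKernel w k) c n (fun j => Z j ω) (fun j => ε j ω) x

theorem norm_kernelMean_le {Ω : Type*} {Z ε : ℕ → Ω → ℝ} {w : ℝ → ℝ} {d : ℕ} {c : ℝ} {n : ℕ} {ω : Ω}
    {σ : ℝ} (hσ : 0 ≤ σ)
    (h : noiseSup w c n Z ε (d + 1) ω ≤ ENNReal.ofReal σ) {x : ℝ}
    (hx : x ∈ Set.Icc (0 : ℝ) 1) :
    ‖fun k : Fin (d + 1) =>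
      kernelMean (monoKernel w k) c n (fun j => Z j ω) (fun j => ε j ω) x‖ ≤ σ :=
  (pi_norm_le_iff_of_nonneg hσ).2 fun k =>
    abs_le_of_supUnit_le hσ ((Finset.le_sup (f := fun k => supUnit fun x =>
      kernelMean (monoKernel w k) c n (fun j => Z j ω) (fun j => ε j ω) x)
      (Finset.mem_range.2 k.2)).trans h) hx

variable {Ω : Type*} [MeasurableSpace Ω] {P : Measure Ω}
  {Z ε : ℕ → Ω → ℝ} {g w : ℝ → ℝ} {β : ℝ} {c : ℕ → ℝ}

theorem noise_eq {d : ℕ} {c : ℝ} (hc : 0 < c) (n : ℕ) (ω : Ω) (x : ℝ) :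
    noise P w d c n Z ε ω x = ((QBar P w d c n Z x)⁻¹.mulVec fun k : Fin (d + 1) =>
      kernelMean (monoKernel w k) c n (fun j => Z j ω) (fun j => ε j ω) x) 0 := by
  rw [← sum_inv_mul_eq (QBar_transpose P w Z d c n x)]
  simp only [noise, ABar, kernelMean, wScaled_eq hc, Finset.mul_sum, Finset.sum_mul]
  rw [Finset.sum_comm]
  refine Finset.sum_congr rfl fun m _ => Finset.sum_congr rfl fun j _ => ?_
  ring

/-- Empirical moments are kernel weighted means of the constant one, so the deviation estimate for
samples applies to them too. -/
theorem IsSample.const_one [IsProbabilityMeasure P] (h : IsSample P Z ε g β) : IsSample P Z (fun _ _ => 1) g β where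
  measurable_Z := h.measurable_Z
  measurable_η _ := measurable_const
  indep := h.indep.comp (fun _ p => (p.1, (1 : ℝ))) fun _ => by fun_prop
  indep_pair _ := indepFun_const_right _ _
  density := h.density
  identDistrib _ := IdentDistrib.refl aemeasurable_const
  integrable := by simp

theorem IsSample.integral_kernelMean_eq_zero [IsProbabilityMeasure P] (h : IsSample P Z ε g β) (hβ : 2 ≤ β)
    (hmean : ∫ ω, ε 0 ω ∂P = 0) {φ : ℝ → ℝ} {L B : ℝ} (hφ : IsLipschitzBump φ L B) {c : ℝ}
    (hc : 0 < c) (n : ℕ) (x : ℝ) :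
    ∫ ω, kernelMean φ c n (fun j => Z j ω) (fun j => ε j ω) x ∂P = 0 := by
  rw [integral_kernelMean hφ hc h.measurable_Z h.measurable_η (h.integrable_η hβ)]
  refine mul_eq_zero_of_right _ (Finset.sum_eq_zero fun j _ => ?_)
  have hm : Measurable fun z => 1 / c * φ ((z - x) / c) := by
    have := hφ.continuous.measurable
    fun_prop
  have hind : IndepFun (fun ω => 1 / c * φ ((Z j ω - x) / c)) (ε j) P :=
    (h.indep_pair j).comp hm measurable_id
  rw [hind.integral_fun_mul_eq_mul_integral
    (hm.comp (h.measurable_Z j)).aestronglyMeasurable (h.measurable_η j).aestronglyMeasurable,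
    (h.identDistrib j).integral_eq, hmean, mul_zero]

/-- The largest uniform deviation among the first `N` kernel moments. -/
noncomputable def momentDeviation (P : Measure Ω) (w : ℝ → ℝ) (c : ℝ) (n : ℕ) (Z : ℕ → Ω → ℝ)
    (N : ℕ) (ω : Ω) : ℝ≥0∞ :=
  (Finset.range N).sup fun k => supUnit fun x =>
    q w c n k (fun j => Z j ω) x - qBar P w c n k Z x

theorem eventually_rate_nonneg (hc : ∀ n, 0 < c n) : ∀ᶠ n in atTop, 0 ≤ rate c n := by
  filter_upwards [eventually_one_le_log, eventually_gt_atTop 0] with n hl hn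
  exact (rate_pos hc hn hl).le

theorem IsSample.isBigOP_momentDeviation [IsProbabilityMeasure P] (h : IsSample P Z ε g β) (hβ : 2 < β)
    (hg : IsCovariateDensity g) (hw : IsKernel w) (hc : ∀ n, 0 < c n)
    (hcβ : (fun n : ℕ => (c n)⁻¹ * (n : ℝ) ^ (2 / β))
      =O[atTop] fun n : ℕ => (n : ℝ) / Real.log n) (N : ℕ) :
    IsBigOP P (fun n => momentDeviation P w (c n) n Z N) (rate c) := by
  refine IsBigOP.finset_sup (X := fun k n ω => supUnit fun x =>
    q w (c n) n k (fun j => Z j ω) x - qBar P w (c n) n k Z x) (fun k => ?_)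
    (eventually_rate_nonneg hc) N
  obtain ⟨L, B, hφ⟩ := hw.exists_isLipschitzBump k
  obtain ⟨Cg, hCg⟩ := hg.bounded
  simpa only [qBar, q_eq_kernelMean (hc _)] using
    h.const_one.isBigOP_supUnit_sub hβ hCg hφ hc hcβ

theorem IsSample.isBigOP_noiseSup [IsProbabilityMeasure P] (h : IsSample P Z ε g β) (hβ : 2 < β)
    (hmean : ∫ ω, ε 0 ω ∂P = 0)
    (hg : IsCovariateDensity g) (hw : IsKernel w) (hc : ∀ n, 0 < c n)
    (hcβ : (fun n : ℕ => (c n)⁻¹ * (n : ℝ) ^ (2 / β))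
      =O[atTop] fun n : ℕ => (n : ℝ) / Real.log n) (N : ℕ) :
    IsBigOP P (fun n => noiseSup w (c n) n Z ε N) (rate c) := by
  refine IsBigOP.finset_sup (X := fun k n ω => supUnit fun x =>
    kernelMean (monoKernel w k) (c n) n (fun j => Z j ω) (fun j => ε j ω) x) (fun k => ?_)
    (eventually_rate_nonneg hc) N
  obtain ⟨L, B, hφ⟩ := hw.exists_isLipschitzBump k
  obtain ⟨Cg, hCg⟩ := hg.bounded
  simpa only [h.integral_kernelMean_eq_zero hβ.le hmean hφ (hc _), sub_zero] using
    h.isBigOP_supUnit_sub hβ hCg hφ hc hcβ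

theorem abs_q_sub_le {c : ℝ} {n N : ℕ} {ω : Ω} {δ : ℝ} (hδ : 0 ≤ δ)
    (h : momentDeviation P w c n Z N ω ≤ ENNReal.ofReal δ) {k : ℕ} (hk : k < N) {x : ℝ}
    (hx : x ∈ Set.Icc (0 : ℝ) 1) :
    |q w c n k (fun j => Z j ω) x - qBar P w c n k Z x| ≤ δ :=
  abs_le_of_supUnit_le hδ ((Finset.le_sup (f := fun k => supUnit fun x =>
    q w c n k (fun j => Z j ω) x - qBar P w c n k Z x) (Finset.mem_range.2 hk)).trans h) hx

theorem IsSample.qBar_zero_le [IsProbabilityMeasure P] (h : IsSample P Z ε g β) {Cg : ℝ} (hCg : 0 ≤ Cg)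
    (hg : ∀ x, g x ≤ Cg) {L B : ℝ} (hφ : IsLipschitzBump (monoKernel w 0) L B) {c : ℝ}
    (hc : 0 < c) {n : ℕ} (hn : 0 < n) (x : ℝ) : qBar P w c n 0 Z x ≤ 2 * B * Cg := by
  have hn' : (0 : ℝ) < n := by exact_mod_cast hn
  simp only [qBar, q_eq_kernelMean hc]
  rw [integral_kernelMean (η := fun _ _ => 1) hφ hc h.measurable_Z (fun _ => measurable_const)
    (fun _ => integrable_const _)]
  have hterm : ∀ j, ∫ ω, 1 / c * monoKernel w 0 ((Z j ω - x) / c) * 1 ∂P ≤ 2 * B * Cg := fun j => by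
    simp only [mul_one]
    rw [integral_const_mul]
    calc _ ≤ 1 / c * (2 * B * Cg * c) := by
          gcongr
          exact h.integral_comp_le hCg hg hφ.continuous.measurable hφ.bounded hφ.support hc j x
      _ = _ := by field_simp
  calc _ ≤ 1 / (n : ℝ) * ∑ j ∈ Finset.range n, 2 * B * Cg :=
        mul_le_mul_of_nonneg_left (Finset.sum_le_sum fun j _ => hterm j) (by positivity)
    _ = _ := by rw [Finset.sum_const, Finset.card_range, nsmul_eq_mul]; field_simp

/-- The linearized noise term is uniformly of order `O_p((n c / log n)^(-1/2))`. -/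
theorem IsSample.isBigOP_supUnit_noise [IsProbabilityMeasure P] (h : IsSample P Z ε g β) (hβ : 2 < β)
    (hmean : ∫ ω, ε 0 ω ∂P = 0)
    (hg : IsCovariateDensity g) (hw : IsKernel w) (d : ℕ) (hc : ∀ n, 0 < c n)
    (hc0 : Tendsto c atTop (𝓝 0))
    (hcβ : (fun n : ℕ => (c n)⁻¹ * (n : ℝ) ^ (2 / β))
      =O[atTop] fun n : ℕ => (n : ℝ) / Real.log n) :
    IsBigOP P (fun n ω => supUnit fun x => noise P w d (c n) n Z ε ω x) (rate c) := by
  obtain ⟨lam, hlam, hcoer⟩ := exists_isCoercive_QBar h.measurable_Z hg h.density hw d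
  intro e he
  obtain ⟨M, hM, hS⟩ := h.isBigOP_noiseSup hβ hmean hg hw hc hcβ (d + 1) e he
  refine ⟨(Fintype.card (Fin (d + 1)) : ℝ) / lam * M, by simp only [Fintype.card_fin]; positivity, ?_⟩
  filter_upwards [hS, eventually_rate_nonneg hc, eventually_gt_atTop 0,
    hc0.eventually_le_const (by norm_num : (0 : ℝ) < 1 / 2)] with n hn hr hn0 hcn
  refine (measure_mono fun ω hω => ?_).trans hn
  simp only [Set.mem_ofPred_eq] at hω ⊢
  contrapose! hω
  refine supUnit_le fun x hx => ?_
  rw [noise_eq (hc n)]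
  refine (norm_le_pi_norm (ι := Fin (d + 1)) (G := fun _ => ℝ) _ 0).trans ?_
  refine ((hcoer n hn0 _ (hc n) hcn x hx).norm_inv_mulVec_le hlam _).trans ?_
  rw [mul_assoc]
  gcongr
  exact norm_kernelMean_le (by positivity) hω hx

/-- The smoother minus its target and the linearized noise, up to `O_p(log n / (n c))` and a
multiple of the error `v` of local polynomial approximation. -/
theorem IsSample.exists_smoother_error_le [IsProbabilityMeasure P] (h : IsSample P Z ε g β) (hβ : 2 < β)
    (hmean : ∫ ω, ε 0 ω ∂P = 0)
    (hg : IsCovariateDensity g) (hw : IsKernel w) (d : ℕ) (hc : ∀ n, 0 < c n)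
    (hc0 : Tendsto c atTop (𝓝 0))
    (hcβ : (fun n : ℕ => (c n)⁻¹ * (n : ℝ) ^ (2 / β))
      =O[atTop] fun n : ℕ => (n : ℝ) / Real.log n)
    {I : Set ℝ} (hZI : ∀ j, ∀ᵐ ω ∂P, Z j ω ∈ I) :
    ∃ C : ℝ, 0 < C ∧ ∀ (r : ℝ → ℝ) (rhat : ℕ → Ω → ℝ → ℝ) (v : ℕ → ℝ),
      (∀ n ω, ∀ x ∈ Set.Icc (0 : ℝ) 1, IsSmootherValue w d (c n) n
        (fun j => Z j ω) (fun j => r (Z j ω) + ε j ω) x (rhat n ω x)) →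
      (∀ n, 0 ≤ v n) →
      (∀ᶠ n in atTop, ∀ x ∈ Set.Icc (0 : ℝ) 1, ∃ b : Fin (d + 1) → ℝ, b 0 = r x ∧
        ∀ z ∈ I, |z - x| ≤ c n → |r z - ∑ m, b m * ((z - x) / c n) ^ (m : ℕ)| ≤ v n) →
      ∃ U V : ℕ → Ω → ℝ≥0∞,
        (∀ n ω, (supUnit fun x => rhat n ω x - r x - noise P w d (c n) n Z ε ω x)
          = U n ω + V n ω) ∧
        IsBigOP P U (fun n => Real.log n / ((n : ℝ) * c n)) ∧
        ∀ n ω, V n ω ≤ ENNReal.ofReal (C * v n) := by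
  obtain ⟨lam, hlam, hcoer⟩ := exists_isCoercive_QBar h.measurable_Z hg h.density hw d
  obtain ⟨L, B, hφ⟩ := hw.exists_isLipschitzBump 0
  obtain ⟨Cg, hCg⟩ := hg.bounded
  have hCg0 : 0 ≤ Cg := (hg.nonneg 0).trans (hCg 0)
  have hB := hφ.bound_nonneg
  set D : ℝ := (Fintype.card (Fin (d + 1)) : ℝ) with hD
  have hDpos : 0 < D := by rw [hD, Fintype.card_fin]; positivity
  refine ⟨D / (lam / 2) * (2 * B * Cg + 1), by positivity, fun r rhat v hrhat hv hloc => ?_⟩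
  refine exists_add_decomposition (fun n => by have := hv n; positivity)
    (.of_forall fun n => by have := hc n; have := Real.log_natCast_nonneg n; positivity) ?_
  intro e he
  -- A single `M` for both suprema. Matrix entries involve the exponents `k + m ≤ 2 * d`, hence `2 *
  -- d + 1` moments.
  obtain ⟨M, hM, hdev⟩ := ((h.isBigOP_momentDeviation hβ hg hw hc hcβ (2 * d + 1)).sup
    (h.isBigOP_noiseSup hβ hmean hg hw hc hcβ (d + 1)) (eventually_rate_nonneg hc)) e he
  -- `M ^ 2` arises from the matrix deviation times the noise, each at most `M * rate c n`.
  refine ⟨D / (lam / 2) * (D * (D / lam) * M ^ 2), by positivity, ?_⟩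
  have hrate0 : Tendsto (fun n => M * rate c n) atTop (𝓝 0) := by
    simpa using (tendsto_rate hc (by linarith) hcβ).const_mul M
  -- Of the last two conditions, the first keeps the empirical mass within 1 of its mean, the second
  -- keeps the empirical matrix coercive.
  filter_upwards [hdev, eventually_rate_nonneg hc, eventually_gt_atTop 0, eventually_one_le_log,
    hc0.eventually_le_const (by norm_num : (0 : ℝ) < 1 / 2), hloc,
    hrate0.eventually_le_const one_pos,
    hrate0.eventually_le_const (by positivity : 0 < lam / 2 / D ^ 2)]
    with n hn hr hn0 hl hcn hlocn hδ1 hδ2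
  -- The covariates lie in `I` only almost surely, so a null set is removed.
  have hnull : P {ω | ¬ ∀ j, Z j ω ∈ I} = 0 := ae_iff.1 (ae_all_iff.2 hZI)
  refine (measure_mono (t := {ω | ENNReal.ofReal (M * rate c n) <
    momentDeviation P w (c n) n Z (2 * d + 1) ω ⊔ noiseSup w (c n) n Z ε (d + 1) ω} ∪
    {ω | ¬ ∀ j, Z j ω ∈ I}) fun ω hω => ?_).trans ((measure_union_le _ _).trans
      (by rw [hnull, add_zero]; exact hn))
  by_contra hcon
  simp only [Set.mem_union, Set.mem_ofPred_eq, not_or, not_not, not_lt, sup_le_iff] at hcon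
  obtain ⟨⟨hQ, hN⟩, hZ⟩ := hcon
  refine absurd hω (not_lt.2 (supUnit_le fun x hx => ?_))
  have hδ : 0 ≤ M * rate c n := by positivity
  obtain ⟨b, hb, hb0⟩ := hrhat n ω x hx
  obtain ⟨b₀, hb₀0, hb₀⟩ := hlocn x hx
  obtain ⟨ρ, hρ, hsys⟩ := exists_QHat_mulVec_eq hw (hc n) hZ hb hb₀ (hv n)
  have hq0 : q w (c n) n 0 (fun j => Z j ω) x ≤ 2 * B * Cg + 1 := by
    have h1 := (abs_le.1 (abs_q_sub_le hδ hQ (by omega : 0 < 2 * d + 1) hx)).2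
    have h2 := h.qBar_zero_le hCg0 hCg hφ (hc n) hn0 x
    linarith
  have hstab := (hcoer n hn0 _ (hc n) hcn x hx).norm_sub_inv_mulVec_le hlam hδ
    (fun k m => abs_q_sub_le hδ hQ (by omega : (k : ℕ) + (m : ℕ) < 2 * d + 1) hx)
    (by rw [← hD, mul_comm]; rwa [le_div_iff₀ (by positivity)] at hδ2) hsys
  have hS := norm_kernelMean_le (d := d) hδ hN hx
  rw [noise_eq (hc n), ← hb0, ← hb₀0]
  refine (norm_le_pi_norm _ (0 : Fin (d + 1))).trans (hstab.trans ?_)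
  rw [← hD, ← rate_sq hc hn0 hl]
  have hvn := hv n
  calc _ ≤ D / (lam / 2) * (D * (M * rate c n) * (D / lam * (M * rate c n))
        + v n * (2 * B * Cg + 1)) := by
        gcongr
        exact hρ.trans (mul_le_mul_of_nonneg_left hq0 hvn)
    _ = _ := by ring

end Noise

end LocalPoly

/-! ### Assembly of the theorem -/

theorem theorem4 {Ω : Type*} [MeasurableSpace Ω] (P : Measure Ω) [IsProbabilityMeasure P]
    (Z ε : ℕ → Ω → ℝ) (hZm : ∀ j, Measurable (Z j)) (hεm : ∀ j, Measurable (ε j))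
    -- the pairs are independent, with independent components, and identically distributed
    (hindep : iIndepFun (fun j ω => (Z j ω, ε j ω)) P)
    (hZε : ∀ j, IndepFun (Z j) (ε j) P)
    (g : ℝ → ℝ) (hg : LocalPoly.IsCovariateDensity g)
    (hZg : ∀ j, P.map (Z j) = volume.withDensity fun z => ENNReal.ofReal (g z))
    (hεid : ∀ j, IdentDistrib (ε j) (ε 0) P P)
    -- the errors have mean zero and a finite moment of order `β > 2`
    (hεmean : ∫ ω, ε 0 ω ∂P = 0)
    (β : ℝ) (hβ : 2 < β) (hεβ : Integrable (fun ω => |ε 0 ω| ^ β) P)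
    -- kernel, degree and bandwidths
    (w : ℝ → ℝ) (hw : LocalPoly.IsKernel w) (d : ℕ)
    (c : ℕ → ℝ) (hcpos : ∀ n, 0 < c n) (hc : Tendsto c atTop (𝓝 0))
    (hcβ : (fun n : ℕ => (c n)⁻¹ * (n : ℝ) ^ (2 / β))
      =O[atTop] fun n : ℕ => (n : ℝ) / Real.log n) :
    LocalPoly.IsBigOP P
      (fun n ω => LocalPoly.supUnit fun x => LocalPoly.noise P w d (c n) n Z ε ω x)
      (fun n => ((n : ℝ) * c n / Real.log n) ^ (-(1 / 2) : ℝ))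
    ∧
    -- `I` is an interval that contains `[0, 1]` and carries the covariates, `r` is the regression
    -- function on `I`, and `rhat n ω x` is any version of the local polynomial smoother
    ∀ (I : Set ℝ) (r : ℝ → ℝ) (rhat : ℕ → Ω → ℝ → ℝ),
      I.OrdConnected → Set.Icc 0 1 ⊆ I → (∀ j, ∀ᵐ ω ∂P, Z j ω ∈ I) →
      (∀ n ω, ∀ x ∈ Set.Icc (0 : ℝ) 1, LocalPoly.IsSmootherValue w d (c n) n
        (fun j => Z j ω) (fun j => r (Z j ω) + ε j ω) x (rhat n ω x)) →
      (∀ ν : ℕ, ν ≤ d → ContDiffOn ℝ ν r I →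
        ∃ U V : ℕ → Ω → ℝ≥0∞,
          (∀ n ω, (LocalPoly.supUnit fun x =>
            rhat n ω x - r x - LocalPoly.noise P w d (c n) n Z ε ω x) = U n ω + V n ω) ∧
          LocalPoly.IsBigOP P U (fun n => Real.log n / ((n : ℝ) * c n)) ∧
          LocalPoly.IsLittleOP P V (fun n => c n ^ ν))
      ∧
      (ContDiffOn ℝ d r I → (∃ K : ℝ≥0, LipschitzOnWith K (iteratedDerivWithin d r I) I) →
        ∃ U V : ℕ → Ω → ℝ≥0∞,
          (∀ n ω, (LocalPoly.supUnit fun x =>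
            rhat n ω x - r x - LocalPoly.noise P w d (c n) n Z ε ω x) = U n ω + V n ω) ∧
          LocalPoly.IsBigOP P U (fun n => Real.log n / ((n : ℝ) * c n)) ∧
          LocalPoly.IsBigOP P V (fun n => c n ^ (d + 1))) := by
  have hsample : LocalPoly.IsSample P Z ε g β := ⟨hZm, hεm, hindep, hZε, hZg, hεid, hεβ⟩
  refine ⟨hsample.isBigOP_supUnit_noise hβ hεmean hg hw d hcpos hc hcβ,
    fun I r rhat hI h01 hZI hrhat => ?_⟩
  obtain ⟨C, hC, hmain⟩ := hsample.exists_smoother_error_le hβ hεmean hg hw d hcpos hc hcβ hZI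
  have hconv : Convex ℝ I := hI.convex
  have huniq : UniqueDiffOn ℝ I := uniqueDiffOn_convex hconv
    ((Set.nonempty_Ioo.2 (zero_lt_one (α := ℝ))).mono
      (by rw [← interior_Icc]; exact interior_mono h01))
  refine ⟨fun ν hν hr => ?_, fun hr ⟨K, hK⟩ => ?_⟩
  · obtain ⟨e, he0, he, hosc⟩ := LocalPoly.exists_modulus hI h01
      (hr.continuousOn_iteratedDerivWithin le_rfl huniq) hc
    obtain ⟨U, V, hUV, hU, hV⟩ := hmain r rhat (fun n => e n * c n ^ ν) hrhat
      (fun n => mul_nonneg (he0 n) (pow_nonneg (hcpos n).le _)) (by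
        filter_upwards [hosc] with n hn x hx
        exact LocalPoly.exists_local_polynomial hconv huniq (h01 hx) (hcpos n) (he0 n) hν hr
          (hn x hx))
    refine ⟨U, V, hUV, hU, LocalPoly.IsLittleOP.of_le hV fun δ hδ => ?_⟩
    have hCe : Tendsto (fun n => C * e n) atTop (𝓝 0) := by simpa using he.const_mul C
    filter_upwards [hCe.eventually_le_const hδ] with n hn
    rw [← mul_assoc]
    exact mul_le_mul_of_nonneg_right hn (pow_nonneg (hcpos n).le _)
  -- The Lipschitz condition bounds the oscillation of the `d`-th derivative over a window by `K * c
  -- n`.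
  · obtain ⟨U, V, hUV, hU, hV⟩ := hmain r rhat (fun n => K * c n * c n ^ d) hrhat
      (fun n => by have := hcpos n; positivity) (.of_forall fun n x hx => by
        refine LocalPoly.exists_local_polynomial hconv huniq (h01 hx) (hcpos n)
          (by have := hcpos n; positivity) le_rfl hr fun y hy hyx => ?_
        have h := hK.dist_le_mul y hy x (h01 hx)
        rw [Real.dist_eq, Real.dist_eq] at h
        exact h.trans (mul_le_mul_of_nonneg_left hyx K.2))
    -- `K + 1` keeps the constant positive when `K = 0`.
    refine ⟨U, V, hUV, hU, LocalPoly.IsBigOP.of_le hV (M := C * (K + 1)) (by positivity)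
      fun n => ?_⟩
    have := hcpos n
    calc C * (K * c n * c n ^ d) = C * K * c n ^ (d + 1) := by ring
      _ ≤ C * (K + 1) * c n ^ (d + 1) := by gcongr; linarith
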